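/- \textbf{Setting.} For every $I\ge 1$ consider a matched study with $I$ matched sets (all quantities below may vary with $I$). Set $i$ has $n_i\ge 1$ subjects and doses $z_{i(1)}\le\dots\le z_{i(n_i)}$; $N=\sum_{i=1}^I n_i$. The potential outcomes $r_{ij}(z)$ are fixed, $r_{ij}^{(k)}=r_{ij}(z_{i(k)})$, and the $f_i^{(k)}$ are prespecified real functions. The estimand is $$\theta=\sum_{i=1}^I\frac{n_i}{N}\theta_i,\qquad \theta_i=\frac1{n_i}\sum_{j=1}^{n_i}\sum_{k=1}^{n_i} f_i^{(k)}\bigl(z_{i(k)},r_{ij}^{(k)}\bigr),$$ and the null hypothesis is $H_{N,\theta_0}:\theta=\theta_0$ (for all large $I$), with $\theta_0$ fixed. Fix the sensitivity parameter $\Gamma=\exp(\gamma)$, $\gamma\in\mathbb R$. For $\mathbf u=(u_{ij})\in[0,1]^N$, the Rosenbaum dose model $P_{\mathbf u}$ draws independent permutations $\pi_i$ of $\{1,\dots,n_i\}$ with $$p_{i\pi}=P_{\mathbf u}(\pi_i=\pi)=\frac{\exp\{\gamma\sum_j z_{i(\pi(j))}u_{ij}\}}{\sum_{\pi'}\exp\{\gamma\sum_j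 z_{i(\pi'(j))}u_{ij}\}},$$ and subject $ij$ receives dose $Z_{ij}=z_{i(\pi_i(j))}$ and shows outcome $R_{ij}=r_{ij}(Z_{ij})$ (different permutations are kept apart even when doses are tied). \textbf{Test.} Let $l_{\Gamma,i}$ and $h_{\Gamma,i}$ be the minimum and the maximum of $p_{i\pi}$ over all permutations $\pi$ and all $\mathbf u_i\in[0,1]^{n_i}$, and $\Gamma_i^*=h_{\Gamma,i}/l_{\Gamma,i}$. Put $V_{N,i}=\sum_{j}\sum_{k} f_i^{(k)}(Z_{ij},R_{ij})\,\mathbf 1\{\pi_i(j)=k\}$ (without ties the indicator is $\mathbf 1\{Z_{ij}=z_{i(k)}\}$), $$V_{N,\Gamma,\theta_0,i}=\frac{1+\Gamma_i^*}{2\,n_i!\,h_{\Gamma,i}}\Bigl(V_{N,i}-\theta_0-\frac{\Gamma_i^*-1}{1+\Gamma_i^*}\,|V_{N,i}-\theta_0|\Bigr),\qquad V_{N,\Gamma,\theta_0}=\sum_{i=1}^I\frac{n_i}{N}V_{N,\Gamma,\theta_0,i}.$$ Let $Q$ be a non-random real $I\times L_I$ matrix, $H_Q=Q(Q^TQ)^{-1}Q^T$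 with diagonal entries $h_{Q_{ii}}$, $W=\mathrm{diag}(In_i/N)$, $\mathbf y=\bigl(V_{N,\Gamma,\theta_0,i}/\sqrt{1-h_{Q_{ii}}}\bigr)_{i\le I}$ (a row vector), and $$S^2_{N,\Gamma,\theta_0}(Q)=I^{-2}\,\mathbf y\,W(\mathcal I-H_Q)W\,\mathbf y^T,\qquad \overline p_{N,\Gamma,\theta_0}=1-\Phi\bigl(V_{N,\Gamma,\theta_0}/S_{N,\Gamma,\theta_0}(Q)\bigr),$$ where $\mathcal I$ is the identity matrix and $\Phi$ the standard normal distribution function. \textbf{Regularity conditions.} Let $\mathcal U_I\subseteq[0,1]^{N}$ be a set of confounder vectors for each $I$ (for instance the whole cube, or a single vector), $\sigma_{\mathbf u}^2=\mathrm{Var}_{\mathbf u}(V_{N,\Gamma,\theta_0})$ and $X_i=\frac{n_i}{N}\bigl(V_{N,\Gamma,\theta_0,i}-E_{\mathbf u}V_{N,\Gamma,\theta_0,i}\bigr)$. Assume: (i) for all large $I$, $Q^TQ$ is invertible, and there is $\delta>0$ with $\max_{i\le I}h_{Q_{ii}}\le 1-\delta$ for all large $I$ (so $L_I<I$); (ii)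 for all large $I$, $\sigma_{\mathbf u}^2>0$ for every $\mathbf u\in\mathcal U_I$; (iii) the Lindeberg condition holds uniformly over $\mathcal U_I$: for every $\varepsilon>0$, for all large $I$ and all $\mathbf u\in\mathcal U_I$, $\sum_{i=1}^I E_{\mathbf u}\bigl[X_i^2\,\mathbf 1\{|X_i|>\varepsilon\sigma_{\mathbf u}\}\bigr]\le\varepsilon\,\sigma_{\mathbf u}^2$. \textbf{Theorem.} Under $H_{N,\theta_0}$ and these conditions, for every $\alpha\in(0,1/2]$, $$\limsup_{I\to\infty}\ \sup_{\mathbf u\in\mathcal U_I}P_{\mathbf u}\bigl[\overline p_{N,\Gamma,\theta_0}\le\alpha\bigr]\le\alpha,$$ that is, for every $\varepsilon>0$, for all large $I$ and all $\mathbf u\in\mathcal U_I$, $P_{\mathbf u}[\overline p_{N,\Gamma,\theta_0}\le\alpha]\le\alpha+\varepsilon$. -/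

import Mathlib

open Filter Topology ProbabilityTheory
open scoped Matrix Nat

noncomputable section

/-- A matched data set with `I` matched sets. Matched set `i` has `n i` subjects and the sorted
doses `dose i 0 ≤ dose i 1 ≤ …`; `outcome i j z` is the fixed potential outcome of subject `j` of
set `i` under dose `z`; `f i k` is the prespecified function attached to the `k`-th dose. -/
structure MatchedStudy (I : ℕ) where
  n : Fin I → ℕ
  n_pos : ∀ i, 0 < n i
  dose : ∀ i, Fin (n i) → ℝ
  dose_mono : ∀ i, Monotone (dose i)
  outcome : ∀ i, Fin (n i) → ℝ → ℝ
  f : ∀ i, Fin (n i) → ℝ → ℝ → ℝ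

/-- The probability, in one matched set with sorted doses `z` and unmeasured confounders `u`, of
the permutation `π` (subject `j` receives the dose `z (π j)`) under the Rosenbaum dose model.
Permutations are kept apart even if some doses are tied. -/
def assignProb {n : ℕ} (γ : ℝ) (z u : Fin n → ℝ) (π : Equiv.Perm (Fin n)) : ℝ :=
  Real.exp (γ * ∑ j, z (π j) * u j) /
    ∑ π' : Equiv.Perm (Fin n), Real.exp (γ * ∑ j, z (π' j) * u j)

/-- The smallest assignment probability, over all permutations and all confounders in the cube
(the infimum of a continuous function on a compact space, hence a minimum). -/
def lowerProb {n : ℕ} (γ : ℝ) (z : Fin n → ℝ) : ℝ :=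
  ⨅ q : Equiv.Perm (Fin n) × (Fin n → Set.Icc (0 : ℝ) 1),
    assignProb γ z (fun j => (q.2 j : ℝ)) q.1

/-- The largest assignment probability, over all permutations and all confounders in the cube. -/
def upperProb {n : ℕ} (γ : ℝ) (z : Fin n → ℝ) : ℝ :=
  ⨆ q : Equiv.Perm (Fin n) × (Fin n → Set.Icc (0 : ℝ) 1),
    assignProb γ z (fun j => (q.2 j : ℝ)) q.1

/-- The hat matrix `Q (Qᵀ Q)⁻¹ Qᵀ`. -/
def hatMatrix {I L : ℕ} (Q : Matrix (Fin I) (Fin L) ℝ) : Matrix (Fin I) (Fin I) ℝ :=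
  Q * (Qᵀ * Q)⁻¹ * Qᵀ

namespace MatchedStudy

variable {I : ℕ} (S : MatchedStudy I)

/-- The total number `N` of subjects. -/
def N : ℕ := ∑ i, S.n i

/-- The contribution `θ_i` of matched set `i` to the estimand. -/
def setTheta (i : Fin I) : ℝ :=
  (S.n i : ℝ)⁻¹ * ∑ j, ∑ k, S.f i k (S.dose i k) (S.outcome i j (S.dose i k))

/-- The estimand `θ`. -/
def theta : ℝ := ∑ i, ((S.n i : ℝ) / S.N) * S.setTheta i

/-- A dose assignment for the whole study: one permutation in each matched set. -/
abbrev Assignment : Type := ∀ i, Equiv.Perm (Fin (S.n i))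

/-- A vector of unmeasured confounders `u_{ij}`. -/
abbrev Confounders : Type := ∀ i, Fin (S.n i) → ℝ

/-- The cube `[0,1]^N` of normalized unmeasured confounders. -/
def cube : Set S.Confounders := {u | ∀ i j, u i j ∈ Set.Icc (0 : ℝ) 1}

/-- The Rosenbaum dose model for the whole study: independence across matched sets. -/
def jointProb (γ : ℝ) (u : S.Confounders) (a : S.Assignment) : ℝ :=
  ∏ i, assignProb γ (S.dose i) (u i) (a i)

open Classical in
/-- The probability of an event under the Rosenbaum dose model. -/
def prob (γ : ℝ) (u : S.Confounders) (A : Set S.Assignment) : ℝ :=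
  ∑ a : S.Assignment, if a ∈ A then S.jointProb γ u a else 0

/-- The expectation of a random variable under the Rosenbaum dose model. -/
def expect (γ : ℝ) (u : S.Confounders) (X : S.Assignment → ℝ) : ℝ :=
  ∑ a : S.Assignment, S.jointProb γ u a * X a

/-- The variance of a random variable under the Rosenbaum dose model. -/
def variance (γ : ℝ) (u : S.Confounders) (X : S.Assignment → ℝ) : ℝ :=
  S.expect γ u fun a => (X a - S.expect γ u X) ^ 2

/-- The dose `Z_{ij}` received by subject `j` of set `i`. -/
def receivedDose (a : S.Assignment) (i : Fin I) (j : Fin (S.n i)) : ℝ := S.dose i (a i j)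

/-- The observed outcome `R_{ij}`. -/
def observedOutcome (a : S.Assignment) (i : Fin I) (j : Fin (S.n i)) : ℝ :=
  S.outcome i j (S.receivedDose a i j)

/-- The estimator `V_{N,i} = ∑_j ∑_k f_i^{(k)}(Z_{ij}, R_{ij}) 1{subject j receives the k-th dose}`.
Without ties the indicator is that of `Z_{ij} = z_{i(k)}`. -/
def setV (a : S.Assignment) (i : Fin I) : ℝ :=
  ∑ j, ∑ k, if a i j = k then S.f i k (S.receivedDose a i j) (S.observedOutcome a i j) else 0

/-- The lower bound `l_{Γ,i}`, with `Γ = exp γ`. -/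
def l (γ : ℝ) (i : Fin I) : ℝ := lowerProb γ (S.dose i)

/-- The upper bound `h_{Γ,i}`, with `Γ = exp γ`. -/
def h (γ : ℝ) (i : Fin I) : ℝ := upperProb γ (S.dose i)

/-- The ratio `Γ_i^* = h_{Γ,i} / l_{Γ,i}`. -/
def gammaStar (γ : ℝ) (i : Fin I) : ℝ := S.h γ i / S.l γ i

/-- The bounding statistic `V_{N,Γ,θ₀,i}` of matched set `i`. -/
def setStat (γ θ₀ : ℝ) (a : S.Assignment) (i : Fin I) : ℝ :=
  (1 + S.gammaStar γ i) / (2 * ((S.n i)! * S.h γ i)) *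
    (S.setV a i - θ₀ - (S.gammaStar γ i - 1) / (1 + S.gammaStar γ i) * |S.setV a i - θ₀|)

/-- The bounding statistic `V_{N,Γ,θ₀}`. -/
def stat (γ θ₀ : ℝ) (a : S.Assignment) : ℝ :=
  ∑ i, ((S.n i : ℝ) / S.N) * S.setStat γ θ₀ a i

/-- The vector `y` with entries `V_{N,Γ,θ₀,i} / √(1 - h_{Q_{ii}})`. -/
def scaledStat {L : ℕ} (Q : Matrix (Fin I) (Fin L) ℝ) (γ θ₀ : ℝ) (a : S.Assignment) : Fin I → ℝ :=
  fun i => S.setStat γ θ₀ a i / √(1 - hatMatrix Q i i)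

/-- The diagonal weight matrix `W` with entries `I n_i / N`. -/
def weightMatrix : Matrix (Fin I) (Fin I) ℝ :=
  Matrix.diagonal fun i => (I : ℝ) * S.n i / S.N

/-- The variance estimator `S²_{N,Γ,θ₀}(Q) = I⁻² y W (1 - H_Q) W yᵀ`. -/
def varEst {L : ℕ} (Q : Matrix (Fin I) (Fin L) ℝ) (γ θ₀ : ℝ) (a : S.Assignment) : ℝ :=
  ((I : ℝ) ^ 2)⁻¹ * (S.scaledStat Q γ θ₀ a ⬝ᵥ
    ((S.weightMatrix * (1 - hatMatrix Q) * S.weightMatrix) *ᵥ S.scaledStat Q γ θ₀ a))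

/-- The bounding p-value `1 - Φ(V_{N,Γ,θ₀} / S_{N,Γ,θ₀}(Q))`. -/
def pValue {L : ℕ} (Q : Matrix (Fin I) (Fin L) ℝ) (γ θ₀ : ℝ) (a : S.Assignment) : ℝ :=
  1 - cdf (gaussianReal 0 1) (S.stat γ θ₀ a / √(S.varEst Q γ θ₀ a))

/-- The centered contribution `(n_i / N) (V_{N,Γ,θ₀,i} - E_u V_{N,Γ,θ₀,i})` of matched set `i`. -/
def centered (γ θ₀ : ℝ) (u : S.Confounders) (i : Fin I) (a : S.Assignment) : ℝ :=
  ((S.n i : ℝ) / S.N) *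
    (S.setStat γ θ₀ a i - S.expect γ u fun b => S.setStat γ θ₀ b i)

open Classical in
/-- The (unnormalized) Lindeberg sum `∑_i E_u[X_i² 1{|X_i| > ε σ_u}]`, where `X_i` are the centered
contributions and `σ_u²` is the variance of `V_{N,Γ,θ₀}`. -/
def lindebergSum (γ θ₀ : ℝ) (u : S.Confounders) (ε : ℝ) : ℝ :=
  ∑ i, S.expect γ u fun a =>
    if ε * √(S.variance γ u (S.stat γ θ₀)) < |S.centered γ θ₀ u i a|
      then S.centered γ θ₀ u i a ^ 2 else 0

end MatchedStudy

end

/-! The bounding transformation sends `v = V_i - θ₀` to `v / (n! h)` when `v ≥ 0` and to `v / (n!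
l)` when `v ≤ 0`. Every permutation has probability between `l` and `h`, so multiplying by that
probability gives at most `v / n!` (`mul_bounding_le`). Summed over permutations, this bounds the
mean of the set statistic by the uniform average `θ_i - θ₀`. Under the null hypothesis the bounding
statistic therefore has nonpositive mean for every confounder vector in the cube
(`expect_stat_nonpos`).

Let `σ` be its true standard deviation. Rejection says that the statistic is at least `z S`, with `z
≥ 0` because `α ≤ 1/2`. If `S² ≥ (1 - η) σ²`, the standardized sum must then exceed `z √(1 - η)`
(`reject_subset`), which by Lindeberg's theorem (`tendsto_wProb_sum_ge`) has limiting probability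
close to `α` for small `η`. Overestimating the variance is harmless, so only a lower bound on `S²`
is needed.

For that bound (`wProb_residual_lt`), `S² / σ²` is the residual quadratic form of `m + e`, where `m`
is deterministic and `e_i = g_i / √(1 - H i i)`. It equals `|(1 - H) m|²`, plus a linear term, plus
`∑ g_i²`, minus an off-diagonal form. The first term absorbs the linear one whatever `m` is, the
diagonal is close to one by the Lindeberg condition, and the off-diagonal form has small variance
because the rows of a projection have squared norm `H i i ≤ 1`.

Uniformity in the confounders comes from taking limits along a countably generated filter on pairs
`(I, u)`, to which Lévy's theorem still applies. -/

/-! ### Finite probability spaces given by weights -/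

/-- A nonnegative weight function of total mass one. -/
structure IsProbWeight {A : Type*} [Fintype A] (P : A → ℝ) : Prop where
  nonneg : ∀ a, 0 ≤ P a
  sum_eq_one : ∑ a, P a = 1

/-- The mean of `X` with respect to the weights `P`. -/
def wMean {A : Type*} [Fintype A] (P X : A → ℝ) : ℝ := ∑ a, P a * X a

open Classical in
/-- The mass of the set `E` with respect to the weights `P`. -/
noncomputable def wProb {A : Type*} [Fintype A] (P : A → ℝ) (E : Set A) : ℝ :=
  ∑ a, if a ∈ E then P a else 0

section wMean

variable {A : Type*} [Fintype A] {P : A → ℝ}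

lemma wMean_add (X Y : A → ℝ) : wMean P (fun a => X a + Y a) = wMean P X + wMean P Y := by
  simp [wMean, mul_add, Finset.sum_add_distrib]

lemma wMean_sub (X Y : A → ℝ) : wMean P (fun a => X a - Y a) = wMean P X - wMean P Y := by
  simp [wMean, mul_sub, Finset.sum_sub_distrib]

lemma wMean_const_mul (c : ℝ) (X : A → ℝ) : wMean P (fun a => c * X a) = c * wMean P X := by
  simp only [wMean, Finset.mul_sum]
  exact Finset.sum_congr rfl fun _ _ => by ring

lemma wMean_sum {κ : Type*} (s : Finset κ) (X : κ → A → ℝ) :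
    wMean P (fun a => ∑ k ∈ s, X k a) = ∑ k ∈ s, wMean P (X k) := by
  simp only [wMean, Finset.mul_sum]
  exact Finset.sum_comm

lemma IsProbWeight.wMean_const (hP : IsProbWeight P) (c : ℝ) : wMean P (fun _ => c) = c := by
  simp [wMean, ← Finset.sum_mul, hP.sum_eq_one]

lemma IsProbWeight.wMean_mono (hP : IsProbWeight P) {X Y : A → ℝ} (h : ∀ a, X a ≤ Y a) :
    wMean P X ≤ wMean P Y :=
  Finset.sum_le_sum fun a _ => mul_le_mul_of_nonneg_left (h a) (hP.nonneg a)

lemma IsProbWeight.wMean_nonneg (hP : IsProbWeight P) {X : A → ℝ} (h : ∀ a, 0 ≤ X a) :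
    0 ≤ wMean P X :=
  Finset.sum_nonneg fun a _ => mul_nonneg (hP.nonneg a) (h a)

lemma IsProbWeight.wMean_sub_sq (hP : IsProbWeight P) (X : A → ℝ) :
    wMean P (fun a => (X a - wMean P X) ^ 2) = wMean P (fun a => X a ^ 2) - wMean P X ^ 2 := by
  have h : (fun a => (X a - wMean P X) ^ 2)
      = fun a => (X a ^ 2 - 2 * wMean P X * X a) + wMean P X ^ 2 := by ext a; ring
  rw [h, wMean_add, wMean_sub, wMean_const_mul, hP.wMean_const]
  ring

lemma IsProbWeight.wProb_mono (hP : IsProbWeight P) {E F : Set A} (h : E ⊆ F) :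
    wProb P E ≤ wProb P F := by
  classical
  refine Finset.sum_le_sum fun a _ => ?_
  have := hP.nonneg a
  by_cases ha : a ∈ E
  · simp [ha, h ha]
  · simp only [ha, if_false]
    split_ifs <;> simp [this]

lemma IsProbWeight.wProb_union_le (hP : IsProbWeight P) (E F : Set A) :
    wProb P (E ∪ F) ≤ wProb P E + wProb P F := by
  classical
  rw [wProb, wProb, wProb, ← Finset.sum_add_distrib]
  refine Finset.sum_le_sum fun a _ => ?_
  have := hP.nonneg a
  by_cases ha : a ∈ E <;> by_cases hb : a ∈ F <;> simp [ha, hb, this]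

/-- Chebyshev's inequality. -/
lemma IsProbWeight.wProb_le_of_sq (hP : IsProbWeight P) {E : Set A} {X : A → ℝ} {c : ℝ}
    (hc : 0 < c) (h : ∀ a ∈ E, c ≤ |X a|) : wProb P E ≤ wMean P (fun a => X a ^ 2) / c ^ 2 := by
  classical
  rw [wProb, wMean, Finset.sum_div]
  refine Finset.sum_le_sum fun a _ => ?_
  have hp := hP.nonneg a
  split_ifs with ha
  · rw [mul_div_assoc]
    refine le_mul_of_one_le_right hp ?_
    rw [one_le_div (by positivity), ← sq_abs (X a)]
    exact pow_le_pow_left₀ hc.le (h a ha) 2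
  · positivity

end wMean

/-! ### Finite product probability spaces -/

/-- The product of a finite family of weights. -/
def prodWeight {ι : Type*} [Fintype ι] {Ω : ι → Type*} (p : ∀ i, Ω i → ℝ) (a : ∀ i, Ω i) : ℝ :=
  ∏ i, p i (a i)

section prodWeight

variable {ι : Type*} [Fintype ι] [DecidableEq ι] {Ω : ι → Type*} [∀ i, Fintype (Ω i)]
  {p : ∀ i, Ω i → ℝ}

lemma IsProbWeight.prodWeight (hp : ∀ i, IsProbWeight (p i)) : IsProbWeight (prodWeight p) where
  nonneg a := Finset.prod_nonneg fun i _ => (hp i).nonneg _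
  sum_eq_one := by
    simp only [_root_.prodWeight]
    rw [← Fintype.prod_sum]
    simp [(hp _).sum_eq_one]

lemma sum_prodWeight_mul_prod (g : ∀ i, Ω i → ℂ) :
    ∑ a, (prodWeight p a : ℂ) * ∏ i, g i (a i) = ∏ i, ∑ x, (p i x : ℂ) * g i x := by
  rw [Fintype.prod_sum]
  simp [prodWeight, Finset.prod_mul_distrib]

/-- Independence: a product of sums expands over all choices of coordinates. The moment identities
below are instances with factors equal to one at the coordinates not involved. -/
lemma wMean_prodWeight_prod (g : ∀ i, Ω i → ℝ) :
    wMean (prodWeight p) (fun a => ∏ i, g i (a i)) = ∏ i, wMean (p i) (g i) := by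
  simp only [wMean]
  rw [Fintype.prod_sum]
  simp [prodWeight, Finset.prod_mul_distrib]

lemma wMean_prodWeight_coord (hp : ∀ i, IsProbWeight (p i)) (g : ∀ i, Ω i → ℝ) (i : ι) :
    wMean (prodWeight p) (fun a => g i (a i)) = wMean (p i) (g i) := by
  have h := wMean_prodWeight_prod (p := p) (fun k x => if k = i then g k x else 1)
  simp only [Finset.prod_ite_eq', Finset.mem_univ, if_true] at h
  rw [h, Finset.prod_eq_single i]
  · simp
  · intro k _ hk
    simp [hk, (hp k).wMean_const]
  · simp

lemma wMean_prodWeight_mul (hp : ∀ i, IsProbWeight (p i)) (g h : ∀ i, Ω i → ℝ) {i j : ι}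
    (hij : i ≠ j) :
    wMean (prodWeight p) (fun a => g i (a i) * h j (a j))
      = wMean (p i) (g i) * wMean (p j) (h j) := by
  have H := wMean_prodWeight_prod (p := p)
    (fun k x => (if k = i then g k x else 1) * (if k = j then h k x else 1))
  simp only [Finset.prod_mul_distrib, Finset.prod_ite_eq', Finset.mem_univ, if_true] at H
  have hterm : ∀ k, wMean (p k)
      (fun x => (if k = i then g k x else 1) * (if k = j then h k x else 1))
      = (if k = i then wMean (p k) (g k) else 1) * (if k = j then wMean (p k) (h k) else 1) := by
    intro k
    by_cases h1 : k = i
    · subst h1; simp [hij]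
    · by_cases h2 : k = j <;> simp [h1, h2, hij.symm, (hp k).wMean_const]
  rw [H, Finset.prod_congr rfl fun k _ => hterm k]
  simp only [Finset.prod_mul_distrib, Finset.prod_ite_eq', Finset.mem_univ, if_true]

/-- A product of four centered coordinate functions has mean zero as soon as one of the coordinates
occurs only once. -/
lemma wMean_prodWeight_four_eq_zero (g : ∀ i, Ω i → ℝ) (hg : ∀ i, wMean (p i) (g i) = 0)
    {i j k l : ι} (hj : i ≠ j) (hk : i ≠ k) (hl : i ≠ l) :
    wMean (prodWeight p) (fun a => g i (a i) * g j (a j) * (g k (a k) * g l (a l))) = 0 := by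
  have H := wMean_prodWeight_prod (p := p)
    (fun m x => (if m = i then g m x else 1) * (if m = j then g m x else 1)
      * ((if m = k then g m x else 1) * (if m = l then g m x else 1)))
  simp only [Finset.prod_mul_distrib, Finset.prod_ite_eq', Finset.mem_univ, if_true] at H
  rw [H]
  refine Finset.prod_eq_zero (Finset.mem_univ i) ?_
  simpa [hj, hk, hl] using hg i

/-- The variance of a sum of independent centered variables. -/
lemma wMean_prodWeight_sum_sq (hp : ∀ i, IsProbWeight (p i)) (g : ∀ i, Ω i → ℝ)
    (hg : ∀ i, wMean (p i) (g i) = 0) :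
    wMean (prodWeight p) (fun a => (∑ i, g i (a i)) ^ 2)
      = ∑ i, wMean (p i) (fun x => g i x ^ 2) := by
  simp only [sq (∑ i, g i _), Finset.sum_mul_sum]
  rw [wMean_sum]
  refine Finset.sum_congr rfl fun i _ => ?_
  rw [wMean_sum, Finset.sum_eq_single i]
  · rw [← wMean_prodWeight_coord hp (fun i x => g i x ^ 2) i]
    simp only [sq]
  · intro j _ hj
    rw [wMean_prodWeight_mul hp g g hj.symm, hg i, zero_mul]
  · simp

/-- The variance of an off-diagonal quadratic form in independent centered variables. -/
lemma wMean_prodWeight_quadratic_sq (hp : ∀ i, IsProbWeight (p i)) (g : ∀ i, Ω i → ℝ)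
    (hg : ∀ i, wMean (p i) (g i) = 0) (c : ι → ι → ℝ) (hdiag : ∀ i, c i i = 0)
    (hsymm : ∀ i j, c i j = c j i) :
    wMean (prodWeight p) (fun a => (∑ i, ∑ j, c i j * (g i (a i) * g j (a j))) ^ 2)
      = 2 * ∑ i, ∑ j, c i j ^ 2 *
        (wMean (p i) (fun x => g i x ^ 2) * wMean (p j) (fun x => g j x ^ 2)) := by
  have hexp : ∀ a : ∀ i, Ω i, (∑ i, ∑ j, c i j * (g i (a i) * g j (a j))) ^ 2
      = ∑ i, ∑ j, ∑ k, ∑ l, c i j * c k l * (g i (a i) * g j (a j) * (g k (a k) * g l (a l))) := by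
    intro a
    rw [sq, Finset.sum_mul]
    refine Finset.sum_congr rfl fun i _ => ?_
    rw [Finset.sum_mul]
    refine Finset.sum_congr rfl fun j _ => ?_
    rw [Finset.mul_sum]
    refine Finset.sum_congr rfl fun k _ => ?_
    rw [Finset.mul_sum]
    exact Finset.sum_congr rfl fun l _ => by ring
  simp only [hexp]
  rw [wMean_sum, Finset.mul_sum]
  refine Finset.sum_congr rfl fun i _ => ?_
  rw [wMean_sum, Finset.mul_sum]
  refine Finset.sum_congr rfl fun j _ => ?_
  rw [wMean_sum]
  simp only [wMean_sum, wMean_const_mul]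
  rcases eq_or_ne i j with rfl | hij
  · simp [hdiag]
  have hsq : wMean (prodWeight p) (fun a => g i (a i) * g j (a j) * (g i (a i) * g j (a j)))
      = wMean (p i) (fun x => g i x ^ 2) * wMean (p j) (fun x => g j x ^ 2) := by
    rw [← wMean_prodWeight_mul hp (fun i x => g i x ^ 2) (fun i x => g i x ^ 2) hij]
    congr 1; ext a; ring
  have hsq' : wMean (prodWeight p) (fun a => g i (a i) * g j (a j) * (g j (a j) * g i (a i)))
      = wMean (p i) (fun x => g i x ^ 2) * wMean (p j) (fun x => g j x ^ 2) := by
    rw [← hsq]; congr 1; ext a; ring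
  -- Only the two pairings of `{i, j}` with itself survive: if `k ≠ l` and `{k, l} ≠ {i, j}`, then
  -- `i` or `j` occurs once in the fourfold product.
  have hz : ∀ k l, ¬ (k = i ∧ l = j) → ¬ (k = j ∧ l = i) →
      c i j * c k l *
        wMean (prodWeight p) (fun a => g i (a i) * g j (a j) * (g k (a k) * g l (a l))) = 0 := by
    intro k l h1 h2
    rcases eq_or_ne k l with rfl | hkl
    · simp [hdiag]
    by_cases hi : i ≠ k ∧ i ≠ l
    · rw [wMean_prodWeight_four_eq_zero g hg hij hi.1 hi.2, mul_zero]
    have hj : j ≠ k ∧ j ≠ l := by grind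
    have := wMean_prodWeight_four_eq_zero (p := p) g hg hij.symm hj.1 hj.2
    rw [mul_eq_zero]; right
    rw [← this]; congr 1; ext a; ring
  rw [Finset.sum_eq_add_of_mem i j (Finset.mem_univ _) (Finset.mem_univ _) hij,
    Finset.sum_eq_single j, Finset.sum_eq_single i, hsq, hsq', hsymm j i]
  · ring
  · intro l _ hl; exact hz j l (by grind) (by grind)
  · simp
  · intro l _ hl; exact hz i l (by grind) (by grind)
  · simp
  · intro k _ hk
    exact Finset.sum_eq_zero fun l _ => hz k l (by grind) (by grind)

end prodWeight

/-! ### The Lindeberg central limit theorem for finite product spaces -/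

/-- Independent centered variables with total variance one whose truncated second moments at level
`ε` sum to at most `ε`. -/
structure IsLindebergArray {ι : Type*} [Fintype ι] {Ω : ι → Type*} [∀ i, Fintype (Ω i)]
    (p g : ∀ i, Ω i → ℝ) (ε : ℝ) : Prop where
  prob : ∀ i, IsProbWeight (p i)
  centered : ∀ i, wMean (p i) (g i) = 0
  sum_sq : ∑ i, wMean (p i) (fun x => g i x ^ 2) = 1
  tail_le : ∑ i, wMean (p i) (fun x => if ε < |g i x| then g i x ^ 2 else 0) ≤ ε

/-- Replace the factors one at a time; all the others lie in the unit disc. -/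
lemma norm_prod_sub_prod_le {ι : Type*} (s : Finset ι) (f g : ι → ℂ) (hf : ∀ i, ‖f i‖ ≤ 1)
    (hg : ∀ i, ‖g i‖ ≤ 1) : ‖∏ i ∈ s, f i - ∏ i ∈ s, g i‖ ≤ ∑ i ∈ s, ‖f i - g i‖ := by
  classical
  induction s using Finset.induction_on with
  | empty => simp
  | insert i s hi ih =>
    rw [Finset.prod_insert hi, Finset.prod_insert hi, Finset.sum_insert hi]
    have hprod : ‖∏ j ∈ s, g j‖ ≤ 1 := by
      rw [norm_prod]
      exact Finset.prod_le_one (fun _ _ => norm_nonneg _) fun j _ => hg j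
    calc ‖f i * ∏ j ∈ s, f j - g i * ∏ j ∈ s, g j‖
        = ‖f i * (∏ j ∈ s, f j - ∏ j ∈ s, g j) + (f i - g i) * ∏ j ∈ s, g j‖ := by ring_nf
      _ ≤ ‖f i‖ * ‖∏ j ∈ s, f j - ∏ j ∈ s, g j‖ + ‖f i - g i‖ * ‖∏ j ∈ s, g j‖ := by
          rw [← norm_mul, ← norm_mul]; exact norm_add_le _ _
      _ ≤ 1 * (∑ j ∈ s, ‖f j - g j‖) + ‖f i - g i‖ * 1 := by
          gcongr
          exact hf i
      _ = _ := by ring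

/-- The cubic bound serves for small values of the variables, the quadratic one for the tails. For
`|x| > 1` the triangle inequality gives `2 + |x| + x² / 2 ≤ 4 x²`. -/
lemma norm_exp_mul_I_sub_taylor_le (x : ℝ) :
    ‖Complex.exp (x * Complex.I) - (1 + x * Complex.I - (x : ℂ) ^ 2 / 2)‖ ≤ 4 * x ^ 2 ∧
    ‖Complex.exp (x * Complex.I) - (1 + x * Complex.I - (x : ℂ) ^ 2 / 2)‖ ≤ 4 * |x| ^ 3 := by
  have h0 := abs_nonneg x
  have key : ‖Complex.exp (x * Complex.I) - (1 + x * Complex.I - (x : ℂ) ^ 2 / 2)‖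
      ≤ if |x| ≤ 1 then |x| ^ 3 else 4 * |x| ^ 2 := by
    split_ifs with h
    · have hn : ‖(x : ℂ) * Complex.I‖ ≤ 1 := by simpa using h
      have hb := Complex.exp_bound hn (n := 3) (by norm_num)
      have hs : ∑ m ∈ Finset.range 3, ((x : ℂ) * Complex.I) ^ m / (m.factorial : ℂ)
          = 1 + x * Complex.I - (x : ℂ) ^ 2 / 2 := by
        simp [Finset.sum_range_succ, mul_pow, Nat.factorial]
        ring
      rw [hs] at hb
      refine hb.trans ?_
      simp only [norm_mul, Complex.norm_real, Complex.norm_I, mul_one, Real.norm_eq_abs]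
      refine mul_le_of_le_one_right (by positivity) ?_
      norm_num [Nat.factorial]
    · push Not at h
      have h1 : ‖Complex.exp (x * Complex.I)‖ = 1 := Complex.norm_exp_ofReal_mul_I x
      have h2 : ‖(x : ℂ) * Complex.I‖ = |x| := by simp
      have h3 : ‖(x : ℂ) ^ 2 / 2‖ = |x| ^ 2 / 2 := by simp
      calc _ ≤ ‖Complex.exp (x * Complex.I)‖ + (‖(1 : ℂ)‖ + ‖(x : ℂ) * Complex.I‖
              + ‖(x : ℂ) ^ 2 / 2‖) := by
            refine (norm_sub_le _ _).trans ?_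
            gcongr
            refine (norm_sub_le _ _).trans ?_
            gcongr
            exact norm_add_le _ _
        _ ≤ 4 * |x| ^ 2 := by
            rw [h1, h2, h3, norm_one]
            nlinarith
  rw [← sq_abs x]
  split_ifs at key with h
  · have h3 : |x| ^ 3 ≤ |x| ^ 2 := pow_le_pow_of_le_one h0 h (by norm_num)
    constructor
    · nlinarith [sq_nonneg |x|]
    · nlinarith [pow_nonneg h0 3]
  · have h3 : |x| ^ 2 ≤ |x| ^ 3 := pow_le_pow_right₀ (by linarith) (by norm_num)
    exact ⟨key, by linarith⟩

lemma abs_exp_neg_sub_le {x : ℝ} (hx : 0 ≤ x) : |Real.exp (-x) - (1 - x)| ≤ x ^ 2 := by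
  by_cases h : x ≤ 1
  · have := Real.norm_exp_sub_one_sub_id_le (x := -x) (by rwa [norm_neg, Real.norm_of_nonneg hx])
    rw [Real.norm_eq_abs, Real.norm_eq_abs, sq_abs, neg_sq] at this
    convert this using 2
    ring
  · have h1 := Real.exp_pos (-x)
    have h2 : Real.exp (-x) ≤ 1 := Real.exp_le_one_iff.2 (by linarith)
    rw [abs_le]
    constructor <;> nlinarith

/-! ### Characteristic functions of sums of independent variables -/

section CharFun

variable {ι : Type*} [Fintype ι] {Ω : ι → Type*} [∀ i, Fintype (Ω i)]
  {p g : ∀ i, Ω i → ℝ} {ε : ℝ}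

/-- The characteristic function of `X` with respect to the weights `P`. -/
noncomputable def wCharFun {A : Type*} [Fintype A] (P X : A → ℝ) (t : ℝ) : ℂ :=
  ∑ a, (P a : ℂ) * Complex.exp ((t * X a : ℝ) * Complex.I)

lemma IsProbWeight.norm_wCharFun_le {A : Type*} [Fintype A] {P : A → ℝ} (hP : IsProbWeight P)
    (X : A → ℝ) (t : ℝ) : ‖wCharFun P X t‖ ≤ 1 := by
  refine (norm_sum_le _ _).trans ?_
  rw [← hP.sum_eq_one]
  refine Finset.sum_le_sum fun a _ => ?_
  rw [norm_mul, Complex.norm_exp_ofReal_mul_I, mul_one, Complex.norm_real,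
    Real.norm_of_nonneg (hP.nonneg a)]

/-- Centering removes the linear Taylor term. The remainder is split at `|X| = ε`: below it one
factor of `|X|³` is bounded by `ε`, above it the quadratic bound is used. -/
lemma IsProbWeight.norm_wCharFun_sub_le {A : Type*} [Fintype A] {P : A → ℝ} (hP : IsProbWeight P)
    {X : A → ℝ} (hX : wMean P X = 0) (hε : 0 < ε) (t : ℝ) :
    ‖wCharFun P X t - (1 - t ^ 2 / 2 * wMean P (fun a => X a ^ 2) : ℝ)‖
      ≤ 4 * |t| ^ 3 * ε * wMean P (fun a => X a ^ 2)
        + 4 * t ^ 2 * wMean P (fun a => if ε < |X a| then X a ^ 2 else 0) := by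
  have hsum : ∑ a, (P a : ℂ) = 1 := by exact_mod_cast hP.sum_eq_one
  have hmean : ∑ a, (P a : ℂ) * (X a : ℂ) = 0 := by exact_mod_cast hX
  have hdec : wCharFun P X t - (1 - t ^ 2 / 2 * wMean P (fun a => X a ^ 2) : ℝ)
      = ∑ a, (P a : ℂ) * (Complex.exp ((t * X a : ℝ) * Complex.I)
        - (1 + (t * X a : ℝ) * Complex.I - ((t * X a : ℝ) : ℂ) ^ 2 / 2)) := by
    have h : ∀ a, (P a : ℂ) * (Complex.exp ((t * X a : ℝ) * Complex.I)
        - (1 + (t * X a : ℝ) * Complex.I - ((t * X a : ℝ) : ℂ) ^ 2 / 2))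
        = (P a : ℂ) * Complex.exp ((t * X a : ℝ) * Complex.I) - P a
          - t * Complex.I * (P a * X a) + (t : ℂ) ^ 2 / 2 * (P a * (X a : ℂ) ^ 2) := by
      intro a; push_cast; ring
    simp only [h, Finset.sum_add_distrib, Finset.sum_sub_distrib, ← Finset.mul_sum, hsum, hmean,
      wCharFun, wMean]
    push_cast
    ring
  rw [hdec]
  refine (norm_sum_le _ _).trans ?_
  rw [← wMean_const_mul, ← wMean_const_mul, ← wMean_add]
  refine Finset.sum_le_sum fun a _ => ?_
  rw [norm_mul, Complex.norm_real, Real.norm_of_nonneg (hP.nonneg a)]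
  refine mul_le_mul_of_nonneg_left ?_ (hP.nonneg a)
  obtain ⟨h2, h3⟩ := norm_exp_mul_I_sub_taylor_le (t * X a)
  beta_reduce
  split_ifs with h
  · have : 0 ≤ 4 * |t| ^ 3 * ε * X a ^ 2 := by positivity
    nlinarith
  · push Not at h
    refine h3.trans ?_
    rw [abs_mul, mul_pow, ← sq_abs (X a)]
    have : |X a| ^ 3 ≤ ε * |X a| ^ 2 := by
      rw [pow_succ']
      exact mul_le_mul_of_nonneg_right h (by positivity)
    have := mul_le_mul_of_nonneg_left this (show 0 ≤ 4 * |t| ^ 3 by positivity)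
    linarith

/-- No single variable carries much variance: values up to `ε` contribute at most `ε ^ 2`, larger
ones at most the whole tail sum. -/
lemma IsLindebergArray.wMean_sq_le (h : IsLindebergArray p g ε) (i : ι) :
    wMean (p i) (fun x => g i x ^ 2) ≤ ε ^ 2 + ε := by
  have h1 : wMean (p i) (fun x => g i x ^ 2)
      ≤ wMean (p i) (fun x => ε ^ 2 + if ε < |g i x| then g i x ^ 2 else 0) := by
    refine (h.prob i).wMean_mono fun x => ?_
    split_ifs with hx
    · nlinarith
    · push Not at hx
      rw [← sq_abs]
      simpa using pow_le_pow_left₀ (abs_nonneg _) hx 2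
  rw [wMean_add, (h.prob i).wMean_const] at h1
  have h2 := Finset.single_le_sum
    (f := fun i => wMean (p i) (fun x => if ε < |g i x| then g i x ^ 2 else 0))
    (fun i _ => (h.prob i).wMean_nonneg fun x => by split_ifs <;> positivity) (Finset.mem_univ i)
  linarith [h.tail_le]

variable [DecidableEq ι]

lemma wCharFun_prodWeight_sum (t : ℝ) :
    wCharFun (prodWeight p) (fun a => ∑ i, g i (a i)) t = ∏ i, wCharFun (p i) (g i) t := by
  rw [wCharFun]
  simp only [wCharFun]
  rw [← sum_prodWeight_mul_prod]
  refine Finset.sum_congr rfl fun a _ => ?_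
  rw [← Complex.exp_sum, Finset.mul_sum, Complex.ofReal_sum, Finset.sum_mul]

/-- Each factor is compared with `exp (-t² v_i / 2)`; these multiply to the Gaussian characteristic
function because the variances `v_i` sum to one. The second-order errors `v_i²` are at most `(ε² +
ε) v_i`, hence summable to something small. -/
lemma IsLindebergArray.norm_wCharFun_sub_le (h : IsLindebergArray p g ε) (hε : 0 < ε) (t : ℝ) :
    ‖wCharFun (prodWeight p) (fun a => ∑ i, g i (a i)) t - Complex.exp (-(t : ℂ) ^ 2 / 2)‖
      ≤ 4 * |t| ^ 3 * ε + 4 * t ^ 2 * ε + (t ^ 2 / 2) ^ 2 * (ε ^ 2 + ε) := by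
  set v : ι → ℝ := fun i => wMean (p i) (fun x => g i x ^ 2) with hv
  have hv0 : ∀ i, 0 ≤ v i := fun i => (h.prob i).wMean_nonneg fun x => sq_nonneg _
  have hexp : Complex.exp (-(t : ℂ) ^ 2 / 2) = ∏ i, (Real.exp (-(t ^ 2 / 2 * v i)) : ℂ) := by
    rw [← Complex.ofReal_prod, ← Real.exp_sum, Finset.sum_neg_distrib, ← Finset.mul_sum, h.sum_sq]
    push_cast
    ring_nf
  rw [wCharFun_prodWeight_sum, hexp]
  refine (norm_prod_sub_prod_le _ _ _ (fun i => (h.prob i).norm_wCharFun_le _ _)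
    fun i => ?_).trans ?_
  · rw [Complex.norm_real, Real.norm_of_nonneg (Real.exp_pos _).le, Real.exp_le_one_iff]
    have := hv0 i
    have : 0 ≤ t ^ 2 / 2 * v i := by positivity
    linarith
  have hterm : ∀ i, ‖wCharFun (p i) (g i) t - (Real.exp (-(t ^ 2 / 2 * v i)) : ℂ)‖
      ≤ 4 * |t| ^ 3 * ε * v i
        + 4 * t ^ 2 * wMean (p i) (fun x => if ε < |g i x| then g i x ^ 2 else 0)
        + (t ^ 2 / 2) ^ 2 * (ε ^ 2 + ε) * v i := by
    intro i
    have h1 := (h.prob i).norm_wCharFun_sub_le (h.centered i) hε t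
    have h2 := abs_exp_neg_sub_le (x := t ^ 2 / 2 * v i) (by have := hv0 i; positivity)
    have h3 : (t ^ 2 / 2 * v i) ^ 2 ≤ (t ^ 2 / 2) ^ 2 * (ε ^ 2 + ε) * v i := by
      have := mul_le_mul_of_nonneg_right (h.wMean_sq_le i) (hv0 i)
      have := mul_le_mul_of_nonneg_left this (sq_nonneg (t ^ 2 / 2))
      calc _ = (t ^ 2 / 2) ^ 2 * (v i * v i) := by ring
        _ ≤ _ := this
        _ = _ := by ring
    rw [abs_sub_comm] at h2
    calc _ = ‖(wCharFun (p i) (g i) t - (1 - t ^ 2 / 2 * v i : ℝ))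
          + ((1 - t ^ 2 / 2 * v i - Real.exp (-(t ^ 2 / 2 * v i)) : ℝ) : ℂ)‖ := by
            congr 1; push_cast; ring
      _ ≤ _ := norm_add_le _ _
      _ ≤ _ := by
        rw [Complex.norm_real, Real.norm_eq_abs]
        linarith
  refine (Finset.sum_le_sum fun i _ => hterm i).trans ?_
  rw [Finset.sum_add_distrib, Finset.sum_add_distrib, ← Finset.mul_sum, ← Finset.mul_sum,
    ← Finset.mul_sum, h.sum_sq]
  have := mul_le_mul_of_nonneg_left h.tail_le (show 0 ≤ 4 * t ^ 2 by positivity)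
  linarith

end CharFun

/-! ### Weak convergence and tail probabilities -/

section Law

open MeasureTheory

variable {A : Type*} [Fintype A]

/-- The law of `X` with respect to the weights `P`. -/
noncomputable def wLaw (P X : A → ℝ) : Measure ℝ :=
  ∑ a, ENNReal.ofReal (P a) • Measure.dirac (X a)

lemma IsProbWeight.isProbabilityMeasure_wLaw {P : A → ℝ} (hP : IsProbWeight P) (X : A → ℝ) :
    IsProbabilityMeasure (wLaw P X) where
  measure_univ := by
    simp only [wLaw, Measure.coe_finsetSum, Finset.sum_apply, Measure.smul_apply, measure_univ,
      smul_eq_mul, mul_one]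
    rw [← ENNReal.ofReal_sum_of_nonneg fun a _ => hP.nonneg a, hP.sum_eq_one, ENNReal.ofReal_one]

lemma IsProbWeight.charFun_wLaw {P : A → ℝ} (hP : IsProbWeight P) (X : A → ℝ) (t : ℝ) :
    charFun (wLaw P X) t = wCharFun P X t := by
  rw [charFun_apply_real, wLaw, integral_finsetSum_measure]
  · refine Finset.sum_congr rfl fun a _ => ?_
    rw [integral_smul_measure, integral_dirac, ENNReal.toReal_ofReal (hP.nonneg a)]
    simp
  · intro a _
    refine Integrable.smul_measure ?_ ENNReal.ofReal_ne_top
    exact integrable_dirac (by simp)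

lemma IsProbWeight.real_wLaw_Ici {P : A → ℝ} (hP : IsProbWeight P) (X : A → ℝ) (x : ℝ) :
    (wLaw P X).real (Set.Ici x) = wProb P {a | x ≤ X a} := by
  classical
  simp only [Measure.real, wLaw, Measure.coe_finsetSum, Finset.sum_apply, Measure.smul_apply,
    Measure.dirac_apply' _ measurableSet_Ici, smul_eq_mul]
  rw [ENNReal.toReal_sum]
  · refine Finset.sum_congr rfl fun a _ => ?_
    rw [ENNReal.toReal_mul, ENNReal.toReal_ofReal (hP.nonneg a)]
    by_cases h : x ≤ X a <;> simp [h]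
  · intro a _
    refine ENNReal.mul_ne_top ENNReal.ofReal_ne_top ?_
    by_cases h : x ≤ X a <;> simp [h]

/-- Lévy's convergence theorem along a countably generated filter. -/
lemma tendsto_probabilityMeasure_of_charFun {κ : Type*} {l : Filter κ} [l.IsCountablyGenerated]
    {μ : κ → ProbabilityMeasure ℝ} {μ₀ : ProbabilityMeasure ℝ}
    (h : ∀ t : ℝ, Tendsto (fun q => charFun (μ q : Measure ℝ) t) l
      (𝓝 (charFun (μ₀ : Measure ℝ) t))) : Tendsto μ l (𝓝 μ₀) :=
  tendsto_of_seq_tendsto fun _ hu =>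
    ProbabilityMeasure.tendsto_of_tendsto_charFun fun t => (h t).comp hu

lemma gaussianReal_real_Ici (x : ℝ) :
    (gaussianReal 0 1).real (Set.Ici x) = 1 - cdf (gaussianReal 0 1) x := by
  have := nullSingletonClass_gaussianReal (μ := 0) (v := 1) one_ne_zero
  rw [cdf_eq_real, ← measureReal_congr (Iio_ae_eq_Iic (a := x)), ← Set.compl_Iio,
    probReal_compl_eq_one_sub measurableSet_Iio]

/-- **Lindeberg's central limit theorem**, on finite product spaces and uniformly along a filter. -/
theorem tendsto_wProb_sum_ge {κ : Type*} {l : Filter κ} [l.IsCountablyGenerated] {ι : κ → Type*}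
    [∀ q, Fintype (ι q)] [∀ q, DecidableEq (ι q)] {Ω : ∀ q, ι q → Type*}
    [∀ q i, Fintype (Ω q i)] {p g : ∀ q i, Ω q i → ℝ} (hp : ∀ q i, IsProbWeight (p q i))
    (h : ∀ ε : ℝ, 0 < ε → ∀ᶠ q in l, IsLindebergArray (p q) (g q) ε) (x : ℝ) :
    Tendsto (fun q => wProb (prodWeight (p q)) {a | x ≤ ∑ i, g q i (a i)}) l
      (𝓝 (1 - cdf (gaussianReal 0 1) x)) := by
  have hP : ∀ q, IsProbWeight (prodWeight (p q)) := fun q => IsProbWeight.prodWeight (hp q)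
  let μ : κ → ProbabilityMeasure ℝ := fun q =>
    ⟨wLaw (prodWeight (p q)) (fun a => ∑ i, g q i (a i)), (hP q).isProbabilityMeasure_wLaw _⟩
  let μ₀ : ProbabilityMeasure ℝ := ⟨gaussianReal 0 1, inferInstance⟩
  have hμ : Tendsto μ l (𝓝 μ₀) := by
    refine tendsto_probabilityMeasure_of_charFun fun t => ?_
    have h0 : charFun (μ₀ : Measure ℝ) t = Complex.exp (-(t : ℂ) ^ 2 / 2) := by
      change charFun (gaussianReal 0 1) t = _
      rw [charFun_gaussianReal]
      congr 1
      push_cast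
      ring
    have h1 : ∀ q, charFun (μ q : Measure ℝ) t
        = wCharFun (prodWeight (p q)) (fun a => ∑ i, g q i (a i)) t :=
      fun q => (hP q).charFun_wLaw _ t
    simp only [h0, h1]
    rw [Metric.tendsto_nhds]
    intro δ hδ
    have hb : Tendsto (fun ε : ℝ => 4 * |t| ^ 3 * ε + 4 * t ^ 2 * ε
        + (t ^ 2 / 2) ^ 2 * (ε ^ 2 + ε)) (𝓝[>] 0) (𝓝 0) := by
      refine Tendsto.mono_left ?_ nhdsWithin_le_nhds
      have : Continuous (fun ε : ℝ => 4 * |t| ^ 3 * ε + 4 * t ^ 2 * ε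
        + (t ^ 2 / 2) ^ 2 * (ε ^ 2 + ε)) := by fun_prop
      simpa using this.tendsto 0
    obtain ⟨ε, hεδ, hε⟩ := ((hb.eventually_lt_const hδ).and self_mem_nhdsWithin).exists
    filter_upwards [h ε hε] with q hq
    rw [dist_eq_norm]
    exact (hq.norm_wCharFun_sub_le hε t).trans_lt hεδ
  -- The portmanteau theorem passes from weak convergence to the half-line, whose boundary point has
  -- no Gaussian mass.
  have hfr : (μ₀ : Measure ℝ) (frontier (Set.Ici x)) = 0 := by
    have := nullSingletonClass_gaussianReal (μ := 0) (v := 1) one_ne_zero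
    rw [frontier_Ici]
    exact measure_singleton (μ := gaussianReal 0 1) x
  have ht := (ENNReal.tendsto_toReal (measure_ne_top _ _)).comp
    (ProbabilityMeasure.tendsto_measure_of_null_frontier_of_tendsto' hμ hfr)
  rw [← gaussianReal_real_Ici]
  exact ht.congr fun q => (hP q).real_wLaw_Ici _ x

end Law

/-! ### The standard normal distribution function and its quantiles -/

section GaussianCdf

open MeasureTheory

lemma continuous_cdf_gaussianReal : Continuous (cdf (gaussianReal 0 1)) := by
  have := nullSingletonClass_gaussianReal (μ := 0) (v := 1) one_ne_zero
  refine continuous_iff_continuousAt.2 fun x => ?_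
  rw [(monotone_cdf _).continuousAt_iff_leftLim_eq_rightLim, StieltjesFunction.rightLim_eq]
  have h := (cdf (gaussianReal 0 1)).measure_singleton x
  rw [measure_cdf, measure_singleton, eq_comm, ENNReal.ofReal_eq_zero] at h
  exact le_antisymm ((monotone_cdf _).leftLim_le le_rfl) (by linarith)

lemma strictMono_cdf_gaussianReal : StrictMono (cdf (gaussianReal 0 1)) := by
  have := (gaussianReal_absolutelyContinuous' 0 (one_ne_zero (α := NNReal))).isOpenPosMeasure
  intro x y hxy
  have h := (cdf (gaussianReal 0 1)).measure_Ioc x y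
  rw [measure_cdf] at h
  have hpos : 0 < gaussianReal 0 1 (Set.Ioc x y) :=
    (isOpen_Ioo.measure_pos _ (Set.nonempty_Ioo.2 hxy)).trans_le
      (measure_mono Set.Ioo_subset_Ioc_self)
  rw [h, ENNReal.ofReal_pos] at hpos
  linarith

lemma cdf_gaussianReal_zero : cdf (gaussianReal 0 1) 0 = 1 / 2 := by
  have h1 := gaussianReal_real_Ici 0
  have h2 : (gaussianReal 0 1).real (Set.Ici 0) = cdf (gaussianReal 0 1) 0 := by
    have := gaussianReal_map_neg (μ := 0) (v := 1)
    rw [neg_zero] at this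
    rw [cdf_eq_real]
    nth_rw 1 [← this]
    rw [map_measureReal_apply measurable_neg measurableSet_Ici]
    simp
  linarith

/-- Quantiles of the standard normal distribution. -/
lemma exists_cdf_gaussianReal_eq {α : ℝ} (h0 : 0 < α) (hα : α ≤ 1 / 2) :
    ∃ z, 0 ≤ z ∧ cdf (gaussianReal 0 1) z = 1 - α := by
  obtain ⟨b, hb⟩ := ((tendsto_cdf_atTop (gaussianReal 0 1)).eventually_const_lt
    (show 1 - α < 1 by linarith)).and (eventually_ge_atTop 0) |>.exists
  -- Since `α ≤ 1/2`, the level `1 - α` is at least the value `1/2` at zero, which makes the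
  -- quantile nonnegative.
  obtain ⟨z, hz, hz'⟩ := intermediate_value_Icc hb.2 continuous_cdf_gaussianReal.continuousOn
    (show 1 - α ∈ Set.Icc _ _ from ⟨by rw [cdf_gaussianReal_zero]; linarith, hb.1.le⟩)
  exact ⟨z, hz.1, hz'⟩

end GaussianCdf

/-! ### Consistency of the residual variance estimator -/

/-- This turns a bound on leverages into a bound on rows, which controls the variance of the
off-diagonal form. -/
lemma diag_eq_sum_sq {ι : Type*} [Fintype ι] {H : Matrix ι ι ℝ} (hH : Hᵀ = H) (hHH : H * H = H)
    (i : ι) : H i i = ∑ j, H i j ^ 2 := by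
  nth_rw 1 [← hHH]
  rw [Matrix.mul_apply]
  refine Finset.sum_congr rfl fun j _ => ?_
  have : H j i = H i j := congrFun (congrFun hH i) j
  rw [this, sq]

section Residual

variable {ι : Type*} [Fintype ι] [DecidableEq ι] {H : Matrix ι ι ℝ}

/-- The residual quadratic form of a projection, expanded around a deterministic vector. -/
lemma residual_quadratic_eq (hH : Hᵀ = H) (m e : ι → ℝ) :
    (m + e) ⬝ᵥ ((1 - H) *ᵥ (m + e))
      = m ⬝ᵥ ((1 - H) *ᵥ m) + 2 * ∑ i, ((1 - H) *ᵥ m) i * e i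
        + (∑ i, (1 - H i i) * e i ^ 2 - ∑ i, ∑ j, (if i = j then 0 else H i j) * (e i * e j)) := by
  have hsymm : m ⬝ᵥ ((1 - H) *ᵥ e) = ∑ i, ((1 - H) *ᵥ m) i * e i := by
    rw [Matrix.dotProduct_mulVec, ← Matrix.mulVec_transpose, Matrix.transpose_sub,
      Matrix.transpose_one, hH]
    rfl
  have hsymm' : e ⬝ᵥ ((1 - H) *ᵥ m) = ∑ i, ((1 - H) *ᵥ m) i * e i := by
    rw [dotProduct_comm]; rfl
  have hquad : e ⬝ᵥ ((1 - H) *ᵥ e)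
      = ∑ i, (1 - H i i) * e i ^ 2 - ∑ i, ∑ j, (if i = j then 0 else H i j) * (e i * e j) := by
    rw [Matrix.sub_mulVec, Matrix.one_mulVec, dotProduct_sub]
    simp only [dotProduct, Matrix.mulVec]
    rw [← Finset.sum_sub_distrib, ← Finset.sum_sub_distrib]
    refine Finset.sum_congr rfl fun i _ => ?_
    have h : ∑ j, H i j * e j = H i i * e i + ∑ j, (if i = j then 0 else H i j) * e j := by
      have : ∀ j, H i j * e j
          = (if i = j then H i i * e i else 0) + (if i = j then 0 else H i j) * e j := by
        intro j
        split_ifs with hij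
        · subst hij; ring
        · ring
      rw [Finset.sum_congr rfl fun j _ => this j, Finset.sum_add_distrib]
      simp
    have h' : ∑ j, (if i = j then 0 else H i j) * (e i * e j)
        = e i * ∑ j, (if i = j then 0 else H i j) * e j := by
      rw [Finset.mul_sum]
      exact Finset.sum_congr rfl fun j _ => by ring
    rw [h, h']
    ring
  rw [Matrix.mulVec_add, dotProduct_add, add_dotProduct, add_dotProduct, hsymm, hsymm', hquad]
  ring

lemma residual_quadratic_eq_sum_sq (hH : Hᵀ = H) (hHH : H * H = H) (m : ι → ℝ) :
    m ⬝ᵥ ((1 - H) *ᵥ m) = ∑ i, ((1 - H) *ᵥ m) i ^ 2 := by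
  have h1 : (1 - H) * (1 - H) = 1 - H := by
    rw [mul_sub, sub_mul, sub_mul, hHH]; simp
  have h2 : (1 - H)ᵀ = 1 - H := by rw [Matrix.transpose_sub, Matrix.transpose_one, hH]
  nth_rw 1 [← h1]
  rw [← Matrix.mulVec_mulVec, Matrix.dotProduct_mulVec, ← Matrix.mulVec_transpose, h2]
  simp [dotProduct, sq]

variable {Ω : ι → Type*} [∀ i, Fintype (Ω i)] {p g : ∀ i, Ω i → ℝ} {ε δ η : ℝ}

/-- The sum of squares is rarely much below its mean. -/
lemma IsLindebergArray.wProb_sum_sq_lt (h : IsLindebergArray p g ε) (hε : 0 < ε) (hη : 0 < η)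
    (hεη : ε ≤ η / 6) :
    wProb (prodWeight p) {a | ∑ i, g i (a i) ^ 2 < 1 - η / 3} ≤ 36 * ε ^ 2 / η ^ 2 := by
  -- Fourth moments of `g` are not controlled, so squares are truncated: `Y ≤ ε²` gives `Y² ≤ ε² g²`
  -- and total variance at most `ε²`. Truncation only lowers the sum, which suffices for a lower
  -- bound.
  set Y : ∀ i, Ω i → ℝ := fun i x => if ε < |g i x| then 0 else g i x ^ 2 with hY
  set Z : ∀ i, Ω i → ℝ := fun i x => Y i x - wMean (p i) (Y i) with hZ
  have hYle : ∀ i x, Y i x ≤ g i x ^ 2 := by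
    intro i x
    simp only [hY]
    split_ifs
    · positivity
    · exact le_rfl
  have hYmean : 1 - ε ≤ ∑ i, wMean (p i) (Y i) := by
    have : ∀ i, wMean (p i) (Y i) = wMean (p i) (fun x => g i x ^ 2)
        - wMean (p i) (fun x => if ε < |g i x| then g i x ^ 2 else 0) := by
      intro i
      rw [← wMean_sub]
      congr 1; ext x
      simp only [hY]
      split_ifs <;> ring
    rw [Finset.sum_congr rfl fun i _ => this i, Finset.sum_sub_distrib, h.sum_sq]
    linarith [h.tail_le]
  have hZmean : ∀ i, wMean (p i) (Z i) = 0 := by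
    intro i
    simp only [hZ]
    rw [wMean_sub, (h.prob i).wMean_const, sub_self]
  have hZsq : ∀ i, wMean (p i) (fun x => Z i x ^ 2) ≤ ε ^ 2 * wMean (p i) (fun x => g i x ^ 2) := by
    intro i
    simp only [hZ]
    rw [(h.prob i).wMean_sub_sq, ← wMean_const_mul]
    have : wMean (p i) (fun x => Y i x ^ 2) ≤ wMean (p i) (fun x => ε ^ 2 * g i x ^ 2) := by
      refine (h.prob i).wMean_mono fun x => ?_
      simp only [hY]
      split_ifs with hx
      · simp; positivity
      · push Not at hx
        have : g i x ^ 2 ≤ ε ^ 2 := by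
          rw [← sq_abs]; exact pow_le_pow_left₀ (abs_nonneg _) hx 2
        nlinarith [sq_nonneg (g i x)]
    linarith [sq_nonneg (wMean (p i) (Y i))]
  -- The truncated sum has mean at least `1 - ε ≥ 1 - η / 6`, so falling below `1 - η / 3` means a
  -- deviation of at least `η / 6`.
  have hcheb := (IsProbWeight.prodWeight h.prob).wProb_le_of_sq
    (E := {a | ∑ i, g i (a i) ^ 2 < 1 - η / 3}) (X := fun a => ∑ i, Z i (a i)) (c := η / 6)
    (by positivity) ?_
  · refine hcheb.trans ?_
    rw [wMean_prodWeight_sum_sq h.prob Z hZmean]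
    have : ∑ i, wMean (p i) (fun x => Z i x ^ 2) ≤ ε ^ 2 := by
      refine (Finset.sum_le_sum fun i _ => hZsq i).trans ?_
      rw [← Finset.mul_sum, h.sum_sq, mul_one]
    calc _ ≤ ε ^ 2 / (η / 6) ^ 2 := by gcongr
      _ = _ := by field_simp; norm_num
  · intro a ha
    rw [Set.mem_ofPred_eq] at ha
    have h1 : ∑ i, Y i (a i) ≤ ∑ i, g i (a i) ^ 2 := Finset.sum_le_sum fun i _ => hYle i _
    have h2 : ∑ i, Z i (a i) = ∑ i, Y i (a i) - ∑ i, wMean (p i) (Y i) := by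
      simp only [hZ, Finset.sum_sub_distrib]
    rw [le_abs]
    right
    linarith

/-- A linear form is rarely large compared with the squared norm of its coefficients. -/
lemma IsLindebergArray.wProb_linear_le (h : IsLindebergArray p g ε) (hε : 0 < ε) (hη : 0 < η)
    (hδ : 0 < δ) (r d : ι → ℝ) (hd : ∀ i, d i ^ 2 ≤ δ⁻¹) :
    wProb (prodWeight p) {a | 2 * ∑ i, r i * (d i * g i (a i)) ≤ -(∑ i, r i ^ 2 + η / 3)}
      ≤ 12 * (ε ^ 2 + ε) / (δ * η) := by
  set M := ∑ i, r i ^ 2 with hM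
  have hM0 : 0 ≤ M := Finset.sum_nonneg fun i _ => sq_nonneg _
  -- The threshold grows with `M`: the variance is of order `M`, while `M / (M + η / 3)² ≤ 3 / η`
  -- for every `M ≥ 0`. This makes the bound independent of `r`.
  have hcheb := (IsProbWeight.prodWeight h.prob).wProb_le_of_sq
    (E := {a | 2 * ∑ i, r i * (d i * g i (a i)) ≤ -(M + η / 3)})
    (X := fun a => ∑ i, (2 * (r i * d i)) * g i (a i)) (c := M + η / 3) (by positivity) ?_
  · refine hcheb.trans ?_
    rw [wMean_prodWeight_sum_sq h.prob (fun i x => (2 * (r i * d i)) * g i x)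
      (fun i => by rw [wMean_const_mul, h.centered, mul_zero])]
    have hle : ∑ i, wMean (p i) (fun x => (2 * (r i * d i) * g i x) ^ 2)
        ≤ 4 * (ε ^ 2 + ε) / δ * M := by
      rw [hM, Finset.mul_sum]
      refine Finset.sum_le_sum fun i _ => ?_
      simp only [mul_pow (2 * (r i * d i))]
      rw [wMean_const_mul]
      calc (2 * (r i * d i)) ^ 2 * wMean (p i) (fun x => g i x ^ 2)
          = 4 * r i ^ 2 * (d i ^ 2 * wMean (p i) (fun x => g i x ^ 2)) := by ring
        _ ≤ 4 * r i ^ 2 * (δ⁻¹ * (ε ^ 2 + ε)) := by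
          refine mul_le_mul_of_nonneg_left ?_ (by positivity)
          refine mul_le_mul (hd i) (h.wMean_sq_le i) ?_ (by positivity)
          exact (h.prob i).wMean_nonneg fun x => sq_nonneg _
        _ = _ := by field_simp
    calc _ ≤ 4 * (ε ^ 2 + ε) / δ * M / (M + η / 3) ^ 2 := by gcongr
      _ ≤ 4 * (ε ^ 2 + ε) / δ * (M + η / 3) / (M + η / 3) ^ 2 := by
          gcongr
          linarith
      _ = 4 * (ε ^ 2 + ε) / δ / (M + η / 3) := by
          field_simp
      _ ≤ 4 * (ε ^ 2 + ε) / δ / (η / 3) := by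
          gcongr
          linarith
      _ = _ := by field_simp; norm_num
  · intro a ha
    rw [Set.mem_ofPred_eq] at ha
    have : ∑ i, (2 * (r i * d i)) * g i (a i) = 2 * ∑ i, r i * (d i * g i (a i)) := by
      rw [Finset.mul_sum]
      exact Finset.sum_congr rfl fun i _ => by ring
    rw [this, le_abs]
    right
    linarith

/-- The off-diagonal part of a projection is negligible. -/
lemma IsLindebergArray.wProb_offDiag_ge (h : IsLindebergArray p g ε) (hε : 0 < ε) (hη : 0 < η)
    (hδ : 0 < δ) (hH : Hᵀ = H) (hHH : H * H = H) (hlev : ∀ i, H i i ≤ 1 - δ) (d : ι → ℝ)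
    (hd : ∀ i, d i ^ 2 ≤ δ⁻¹) :
    wProb (prodWeight p) {a | η / 3 ≤ ∑ i, ∑ j, (if i = j then 0 else H i j) *
        (d i * g i (a i) * (d j * g j (a j)))}
      ≤ 18 * (ε ^ 2 + ε) / (δ ^ 2 * η ^ 2) := by
  set c : ι → ι → ℝ := fun i j => (if i = j then 0 else H i j) * (d i * d j) with hc
  have hsymm : ∀ i j, H i j = H j i := fun i j => (congrFun (congrFun hH i) j).symm
  have hcheb := (IsProbWeight.prodWeight h.prob).wProb_le_of_sq
    (E := {a | η / 3 ≤ ∑ i, ∑ j, (if i = j then 0 else H i j) *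
        (d i * g i (a i) * (d j * g j (a j)))})
    (X := fun a => ∑ i, ∑ j, c i j * (g i (a i) * g j (a j))) (c := η / 3) (by positivity) ?_
  · refine hcheb.trans ?_
    rw [wMean_prodWeight_quadratic_sq h.prob g h.centered c (fun i => by simp [hc])
      (fun i j => by simp only [hc, eq_comm (a := i), hsymm i j]; ring)]
    have hv : ∀ i, 0 ≤ wMean (p i) (fun x => g i x ^ 2) :=
      fun i => (h.prob i).wMean_nonneg fun x => sq_nonneg _
    have hterm : ∀ i j, c i j ^ 2 *
        (wMean (p i) (fun x => g i x ^ 2) * wMean (p j) (fun x => g j x ^ 2))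
        ≤ (ε ^ 2 + ε) / δ ^ 2 * wMean (p i) (fun x => g i x ^ 2) * H i j ^ 2 := by
      intro i j
      have h1 : c i j ^ 2 ≤ H i j ^ 2 * (δ⁻¹ * δ⁻¹) := by
        simp only [hc, mul_pow]
        refine mul_le_mul ?_ (mul_le_mul (hd i) (hd j) (sq_nonneg _) (by positivity))
          (by positivity) (sq_nonneg _)
        split_ifs
        · simpa using sq_nonneg (H i j)
        · exact le_rfl
      calc _ ≤ H i j ^ 2 * (δ⁻¹ * δ⁻¹) * (wMean (p i) (fun x => g i x ^ 2) * (ε ^ 2 + ε)) := by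
            have := hv i
            have := hv j
            gcongr
            exact h.wMean_sq_le j
        _ = _ := by field_simp
    have hsum : ∑ i, ∑ j, c i j ^ 2 *
        (wMean (p i) (fun x => g i x ^ 2) * wMean (p j) (fun x => g j x ^ 2))
        ≤ (ε ^ 2 + ε) / δ ^ 2 := by
      refine (Finset.sum_le_sum fun i _ => Finset.sum_le_sum fun j _ => hterm i j).trans ?_
      calc _ = ∑ i, (ε ^ 2 + ε) / δ ^ 2 * wMean (p i) (fun x => g i x ^ 2) * H i i := by
            refine Finset.sum_congr rfl fun i _ => ?_
            rw [← Finset.mul_sum, ← diag_eq_sum_sq hH hHH]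
        _ ≤ ∑ i, (ε ^ 2 + ε) / δ ^ 2 * wMean (p i) (fun x => g i x ^ 2) := by
            refine Finset.sum_le_sum fun i _ => ?_
            have := hv i
            exact mul_le_of_le_one_right (by positivity) (by linarith [hlev i])
        _ = _ := by rw [← Finset.mul_sum, h.sum_sq, mul_one]
    calc _ ≤ 2 * ((ε ^ 2 + ε) / δ ^ 2) / (η / 3) ^ 2 := by gcongr
      _ = _ := by field_simp; norm_num
  · intro a ha
    rw [Set.mem_ofPred_eq] at ha
    have : ∑ i, ∑ j, c i j * (g i (a i) * g j (a j)) = ∑ i, ∑ j, (if i = j then 0 else H i j) *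
        (d i * g i (a i) * (d j * g j (a j))) :=
      Finset.sum_congr rfl fun i _ => Finset.sum_congr rfl fun j _ => by simp only [hc]; ring
    rw [this]
    exact ha.trans (le_abs_self _)

/-- The residual sum of squares of the leverage-corrected variables, around an arbitrary
deterministic vector `m`, is rarely much smaller than the total variance. -/
theorem IsLindebergArray.wProb_residual_lt (h : IsLindebergArray p g ε) (hε : 0 < ε) (hη : 0 < η)
    (hεη : ε ≤ η / 6) (hδ : 0 < δ) (hH : Hᵀ = H) (hHH : H * H = H) (hlev : ∀ i, H i i ≤ 1 - δ)
    (m : ι → ℝ) :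
    wProb (prodWeight p) {a | (m + fun i => (√(1 - H i i))⁻¹ * g i (a i)) ⬝ᵥ
        ((1 - H) *ᵥ (m + fun i => (√(1 - H i i))⁻¹ * g i (a i))) < 1 - η}
      ≤ 36 * ε ^ 2 / η ^ 2 + 12 * (ε ^ 2 + ε) / (δ * η)
        + 18 * (ε ^ 2 + ε) / (δ ^ 2 * η ^ 2) := by
  set d : ι → ℝ := fun i => (√(1 - H i i))⁻¹ with hddef
  have hpos : ∀ i, 0 < 1 - H i i := fun i => by linarith [hlev i]
  have hdsq : ∀ i, d i ^ 2 = (1 - H i i)⁻¹ := fun i => by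
    simp only [hddef]
    rw [inv_pow, Real.sq_sqrt (hpos i).le]
  have hd : ∀ i, d i ^ 2 ≤ δ⁻¹ := fun i => by
    rw [hdsq]
    exact inv_anti₀ hδ (by linarith [hlev i])
  have hP := IsProbWeight.prodWeight h.prob
  refine le_trans ?_ (add_le_add (add_le_add (h.wProb_sum_sq_lt hε hη hεη)
    (h.wProb_linear_le hε hη hδ ((1 - H) *ᵥ m) d hd))
    (h.wProb_offDiag_ge hε hη hδ hH hHH hlev d hd))
  refine le_trans (hP.wProb_mono ?_) ((hP.wProb_union_le _ _).trans
    (add_le_add_left (hP.wProb_union_le _ _) _))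
  intro a ha
  rw [Set.mem_ofPred_eq, residual_quadratic_eq hH, residual_quadratic_eq_sum_sq hH hHH] at ha
  -- The leverage correction exactly cancels the shrinkage of the diagonal.
  have hdiag : ∑ i, (1 - H i i) * (d i * g i (a i)) ^ 2 = ∑ i, g i (a i) ^ 2 := by
    refine Finset.sum_congr rfl fun i _ => ?_
    rw [mul_pow, hdsq, ← mul_assoc, mul_inv_cancel₀ (hpos i).ne', one_mul]
  rw [hdiag] at ha
  -- Outside the three events the form exceeds `M - (M + η / 3) + (1 - η / 3) - η / 3 = 1 - η`,
  -- where `M` is the squared norm of `(1 - H) *ᵥ m`.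
  by_contra hcon
  simp only [Set.mem_union, Set.mem_ofPred_eq, not_or, not_lt, not_le] at hcon
  linarith [hcon.1.1, hcon.1.2, hcon.2]

end Residual

lemma hatMatrix_transpose {I L : ℕ} (Q : Matrix (Fin I) (Fin L) ℝ) :
    (hatMatrix Q)ᵀ = hatMatrix Q := by
  simp [hatMatrix, Matrix.transpose_mul, Matrix.transpose_nonsing_inv, Matrix.mul_assoc]

lemma hatMatrix_mul_self {I L : ℕ} {Q : Matrix (Fin I) (Fin L) ℝ} (hQ : IsUnit (Qᵀ * Q).det) :
    hatMatrix Q * hatMatrix Q = hatMatrix Q := by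
  have : hatMatrix Q * hatMatrix Q = Q * ((Qᵀ * Q)⁻¹ * (Qᵀ * Q)) * (Qᵀ * Q)⁻¹ * Qᵀ := by
    simp only [hatMatrix, Matrix.mul_assoc]
  rw [this, Matrix.nonsing_inv_mul _ hQ, Matrix.mul_one, hatMatrix]

/-! ### The Rosenbaum dose model in one matched set -/

section AssignProb

variable {n : ℕ} (γ : ℝ) (z u : Fin n → ℝ)

lemma isProbWeight_assignProb : IsProbWeight (assignProb γ z u) where
  nonneg π := by unfold assignProb; positivity
  sum_eq_one := by
    simp only [assignProb]
    rw [← Finset.sum_div, div_self]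
    exact (Finset.sum_pos (fun _ _ => Real.exp_pos _) Finset.univ_nonempty).ne'

lemma assignProb_le_one (π : Equiv.Perm (Fin n)) : assignProb γ z u π ≤ 1 := by
  have h := isProbWeight_assignProb γ z u
  rw [← h.sum_eq_one]
  exact Finset.single_le_sum (fun π _ => h.nonneg π) (Finset.mem_univ π)

variable {u}

lemma abs_exponent_le (hu : ∀ j, u j ∈ Set.Icc (0 : ℝ) 1) (π : Equiv.Perm (Fin n)) :
    |γ * ∑ j, z (π j) * u j| ≤ |γ| * ∑ j, |z j| := by
  rw [abs_mul]
  refine mul_le_mul_of_nonneg_left ?_ (abs_nonneg _)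
  refine (Finset.abs_sum_le_sum_abs _ _).trans ?_
  rw [← Equiv.sum_comp π fun j => |z j|]
  refine Finset.sum_le_sum fun j _ => ?_
  rw [abs_mul, abs_of_nonneg (hu j).1]
  exact mul_le_of_le_one_right (abs_nonneg _) (hu j).2

/-- The exponents are bounded uniformly over the cube, so all assignment probabilities share a
positive lower bound and the ratio `h / l` is a genuine quotient. -/
lemma lowerProb_pos : 0 < lowerProb γ z := by
  set B := |γ| * ∑ j, |z j| with hB
  have hc : 0 < Real.exp (-B) / ∑ _π : Equiv.Perm (Fin n), Real.exp B :=
    div_pos (Real.exp_pos _) (Finset.sum_pos (fun _ _ => Real.exp_pos _) Finset.univ_nonempty)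
  have : Nonempty (Fin n → Set.Icc (0 : ℝ) 1) := ⟨fun _ => ⟨0, by simp⟩⟩
  refine hc.trans_le (le_ciInf fun q => ?_)
  have h := fun π => abs_le.1 (abs_exponent_le γ z (u := fun j => (q.2 j : ℝ))
    (fun j => (q.2 j).2) π)
  refine div_le_div₀ (Real.exp_pos _).le (Real.exp_le_exp.2 (h q.1).1)
    (Finset.sum_pos (fun _ _ => Real.exp_pos _) Finset.univ_nonempty) ?_
  exact Finset.sum_le_sum fun π _ => Real.exp_le_exp.2 (h π).2

lemma lowerProb_le (hu : ∀ j, u j ∈ Set.Icc (0 : ℝ) 1) (π : Equiv.Perm (Fin n)) :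
    lowerProb γ z ≤ assignProb γ z u π := by
  refine ciInf_le (f := fun q : Equiv.Perm (Fin n) × (Fin n → Set.Icc (0 : ℝ) 1) =>
    assignProb γ z (fun j => (q.2 j : ℝ)) q.1) ⟨0, ?_⟩ (π, fun j => ⟨u j, hu j⟩)
  rintro _ ⟨q, rfl⟩
  exact (isProbWeight_assignProb γ z _).nonneg _

lemma le_upperProb (hu : ∀ j, u j ∈ Set.Icc (0 : ℝ) 1) (π : Equiv.Perm (Fin n)) :
    assignProb γ z u π ≤ upperProb γ z := by
  refine le_ciSup (f := fun q : Equiv.Perm (Fin n) × (Fin n → Set.Icc (0 : ℝ) 1) =>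
    assignProb γ z (fun j => (q.2 j : ℝ)) q.1) ⟨1, ?_⟩ (π, fun j => ⟨u j, hu j⟩)
  rintro _ ⟨q, rfl⟩
  exact assignProb_le_one γ z _ _

end AssignProb

/-- The bounding transformation undoes any weight between `l` and `h` conservatively. -/
lemma mul_bounding_le {F l h p v : ℝ} (hF : 0 < F) (hl : 0 < l) (hlp : l ≤ p) (hph : p ≤ h) :
    p * ((1 + h / l) / (2 * (F * h)) * (v - (h / l - 1) / (1 + h / l) * |v|)) ≤ F⁻¹ * v := by
  have hh : 0 < h := by linarith
  have hp : 0 < p := by linarith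
  rcases le_total 0 v with hv | hv
  · rw [abs_of_nonneg hv]
    have : p * ((1 + h / l) / (2 * (F * h)) * (v - (h / l - 1) / (1 + h / l) * v))
        = p / h * (F⁻¹ * v) := by field_simp; ring
    rw [this]
    exact mul_le_of_le_one_left (by positivity) ((div_le_one hh).2 hph)
  · rw [abs_of_nonpos hv]
    have : p * ((1 + h / l) / (2 * (F * h)) * (v - (h / l - 1) / (1 + h / l) * -v))
        = p / l * (F⁻¹ * v) := by field_simp; ring
    rw [this]
    have h1 : F⁻¹ * v ≤ 0 := mul_nonpos_of_nonneg_of_nonpos (by positivity) hv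
    have h2 : 1 ≤ p / l := (one_le_div hl).2 hlp
    nlinarith

/-- A uniformly random permutation sends each point to a uniformly random point. -/
lemma card_mul_sum_perm_apply {n : ℕ} (F : Fin n → ℝ) (j : Fin n) :
    (n : ℝ) * ∑ π : Equiv.Perm (Fin n), F (π j) = (n ! : ℝ) * ∑ k, F k := by
  have h : ∀ j', ∑ π : Equiv.Perm (Fin n), F (π j') = ∑ π : Equiv.Perm (Fin n), F (π j) := by
    intro j'
    -- Precomposing with the transposition of `j` and `j'` permutes the permutations, so the sum
    -- does not depend on the point; averaging over points then gives the claim.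
    refine Fintype.sum_equiv (Equiv.mulRight (Equiv.swap j j')) _ _ fun π => ?_
    simp
  calc (n : ℝ) * ∑ π : Equiv.Perm (Fin n), F (π j)
      = ∑ j', ∑ π : Equiv.Perm (Fin n), F (π j') := by simp [h]
    _ = ∑ π : Equiv.Perm (Fin n), ∑ j', F (π j') := Finset.sum_comm
    _ = ∑ _π : Equiv.Perm (Fin n), ∑ k, F k :=
        Finset.sum_congr rfl fun π _ => Equiv.sum_comp π F
    _ = _ := by simp [Fintype.card_perm]

/-! ### The bounding statistic -/

namespace MatchedStudy

variable {I : ℕ} (S : MatchedStudy I)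

/-- The estimator of matched set `i`, as a function of the permutation of that set. -/
def setVOf (i : Fin I) (π : Equiv.Perm (Fin (S.n i))) : ℝ :=
  ∑ j, S.f i (π j) (S.dose i (π j)) (S.outcome i j (S.dose i (π j)))

lemma setV_eq (a : S.Assignment) (i : Fin I) : S.setV a i = S.setVOf i (a i) := by
  simp [setV, setVOf, receivedDose, observedOutcome]

/-- The bounding statistic of matched set `i`, as a function of the permutation of that set. -/
noncomputable def setStatOf (γ θ₀ : ℝ) (i : Fin I) (π : Equiv.Perm (Fin (S.n i))) : ℝ :=
  (1 + S.gammaStar γ i) / (2 * ((S.n i)! * S.h γ i)) *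
    (S.setVOf i π - θ₀ - (S.gammaStar γ i - 1) / (1 + S.gammaStar γ i) * |S.setVOf i π - θ₀|)

lemma setStat_eq (γ θ₀ : ℝ) (a : S.Assignment) (i : Fin I) :
    S.setStat γ θ₀ a i = S.setStatOf γ θ₀ i (a i) := by
  rw [setStat, setStatOf, setV_eq]

/-- The weights of the permutations in the matched sets. -/
noncomputable def weights (γ : ℝ) (u : S.Confounders) (i : Fin I) : Equiv.Perm (Fin (S.n i)) → ℝ :=
  assignProb γ (S.dose i) (u i)

lemma isProbWeight_weights (γ : ℝ) (u : S.Confounders) (i : Fin I) :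
    IsProbWeight (S.weights γ u i) :=
  isProbWeight_assignProb _ _ _

lemma prob_eq (γ : ℝ) (u : S.Confounders) (E : Set S.Assignment) :
    S.prob γ u E = wProb (prodWeight (S.weights γ u)) E := rfl

lemma expect_eq (γ : ℝ) (u : S.Confounders) (X : S.Assignment → ℝ) :
    S.expect γ u X = wMean (prodWeight (S.weights γ u)) X := rfl

lemma sum_setVOf (i : Fin I) :
    ((S.n i)! : ℝ)⁻¹ * ∑ π, S.setVOf i π = S.setTheta i := by
  have hn : (S.n i : ℝ) ≠ 0 := by exact_mod_cast (S.n_pos i).ne'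
  have hf : ((S.n i)! : ℝ) ≠ 0 := by exact_mod_cast Nat.factorial_ne_zero _
  simp only [setVOf, setTheta]
  rw [Finset.sum_comm, Finset.mul_sum, Finset.mul_sum]
  refine Finset.sum_congr rfl fun j _ => ?_
  have h := card_mul_sum_perm_apply
    (fun k => S.f i k (S.dose i k) (S.outcome i j (S.dose i k))) j
  rw [inv_mul_eq_iff_eq_mul₀ hf, ← mul_right_inj' hn, h]
  field_simp

/-- The bounding statistic of a matched set has mean at most `θ_i - θ₀`. -/
lemma wMean_setStatOf_le (γ θ₀ : ℝ) {u : S.Confounders} (hu : u ∈ S.cube) (i : Fin I) :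
    wMean (S.weights γ u i) (S.setStatOf γ θ₀ i) ≤ S.setTheta i - θ₀ := by
  have hf : (0 : ℝ) < (S.n i)! := by exact_mod_cast Nat.factorial_pos _
  calc wMean (S.weights γ u i) (S.setStatOf γ θ₀ i)
      ≤ ∑ π, ((S.n i)! : ℝ)⁻¹ * (S.setVOf i π - θ₀) :=
        Finset.sum_le_sum fun π _ => mul_bounding_le hf (lowerProb_pos γ (S.dose i))
          (lowerProb_le γ (S.dose i) (hu i) π) (le_upperProb γ (S.dose i) (hu i) π)
    _ = S.setTheta i - θ₀ := by
        rw [← Finset.mul_sum, Finset.sum_sub_distrib, mul_sub, sum_setVOf]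
        simp [Fintype.card_perm, hf.ne']

lemma N_pos (hI : 0 < I) : 0 < S.N := by
  have : Nonempty (Fin I) := ⟨⟨0, hI⟩⟩
  exact Finset.sum_pos (fun i _ => S.n_pos i) Finset.univ_nonempty

/-- The mean of the bounding statistic of a matched set. -/
noncomputable def setMean (γ θ₀ : ℝ) (u : S.Confounders) (i : Fin I) : ℝ :=
  wMean (S.weights γ u i) (S.setStatOf γ θ₀ i)

lemma expect_setStat (γ θ₀ : ℝ) (u : S.Confounders) (i : Fin I) :
    (S.expect γ u fun b => S.setStat γ θ₀ b i) = S.setMean γ θ₀ u i := by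
  simp only [setStat_eq]
  exact wMean_prodWeight_coord (S.isProbWeight_weights γ u) (S.setStatOf γ θ₀) i

/-- The centered contribution of matched set `i`, as a function of the permutation of that set. -/
noncomputable def centeredOf (γ θ₀ : ℝ) (u : S.Confounders) (i : Fin I)
    (π : Equiv.Perm (Fin (S.n i))) : ℝ :=
  (S.n i : ℝ) / S.N * (S.setStatOf γ θ₀ i π - S.setMean γ θ₀ u i)

lemma centered_eq (γ θ₀ : ℝ) (u : S.Confounders) (i : Fin I) (a : S.Assignment) :
    S.centered γ θ₀ u i a = S.centeredOf γ θ₀ u i (a i) := by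
  rw [centered, expect_setStat, setStat_eq, centeredOf]

lemma wMean_centeredOf (γ θ₀ : ℝ) (u : S.Confounders) (i : Fin I) :
    wMean (S.weights γ u i) (S.centeredOf γ θ₀ u i) = 0 := by
  have : S.centeredOf γ θ₀ u i = fun π =>
    (S.n i : ℝ) / S.N * (S.setStatOf γ θ₀ i π - S.setMean γ θ₀ u i) := rfl
  rw [this, wMean_const_mul, wMean_sub, (S.isProbWeight_weights γ u i).wMean_const, setMean,
    sub_self, mul_zero]

lemma expect_stat (γ θ₀ : ℝ) (u : S.Confounders) :
    S.expect γ u (S.stat γ θ₀) = ∑ i, (S.n i : ℝ) / S.N * S.setMean γ θ₀ u i := by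
  have : S.stat γ θ₀ = fun a => ∑ i, (S.n i : ℝ) / S.N * S.setStat γ θ₀ a i := rfl
  rw [expect_eq, this, wMean_sum]
  refine Finset.sum_congr rfl fun i _ => ?_
  rw [wMean_const_mul, ← expect_eq, expect_setStat]

lemma stat_sub_expect (γ θ₀ : ℝ) (u : S.Confounders) (a : S.Assignment) :
    S.stat γ θ₀ a - S.expect γ u (S.stat γ θ₀) = ∑ i, S.centeredOf γ θ₀ u i (a i) := by
  rw [expect_stat, stat, ← Finset.sum_sub_distrib]
  refine Finset.sum_congr rfl fun i _ => ?_
  rw [setStat_eq, centeredOf]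
  ring

lemma expect_stat_nonpos (hI : 0 < I) {γ θ₀ : ℝ} (hθ : S.theta = θ₀) {u : S.Confounders}
    (hu : u ∈ S.cube) : S.expect γ u (S.stat γ θ₀) ≤ 0 := by
  have hN : (0 : ℝ) < S.N := by exact_mod_cast S.N_pos hI
  have hw : ∑ i, (S.n i : ℝ) / S.N = 1 := by
    rw [← Finset.sum_div, div_eq_one_iff_eq hN.ne', N, Nat.cast_sum]
  rw [expect_stat]
  calc _ ≤ ∑ i, (S.n i : ℝ) / S.N * (S.setTheta i - θ₀) :=
        Finset.sum_le_sum fun i _ => mul_le_mul_of_nonneg_left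
          (S.wMean_setStatOf_le γ θ₀ hu i) (by positivity)
    _ = 0 := by
        simp only [mul_sub, Finset.sum_sub_distrib]
        rw [← Finset.sum_mul, hw, one_mul, ← hθ, theta, sub_self]

lemma variance_stat (γ θ₀ : ℝ) (u : S.Confounders) :
    S.variance γ u (S.stat γ θ₀)
      = ∑ i, wMean (S.weights γ u i) (fun π => S.centeredOf γ θ₀ u i π ^ 2) := by
  rw [variance]
  simp only [stat_sub_expect]
  exact wMean_prodWeight_sum_sq (S.isProbWeight_weights γ u) _ (S.wMean_centeredOf γ θ₀ u)

lemma lindebergSum_eq (γ θ₀ : ℝ) (u : S.Confounders) (ε : ℝ) :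
    S.lindebergSum γ θ₀ u ε = ∑ i, wMean (S.weights γ u i) (fun π =>
      if ε * √(S.variance γ u (S.stat γ θ₀)) < |S.centeredOf γ θ₀ u i π|
        then S.centeredOf γ θ₀ u i π ^ 2 else 0) := by
  classical
  rw [lindebergSum]
  refine Finset.sum_congr rfl fun i _ => ?_
  simp only [centered_eq]
  rw [← wMean_prodWeight_coord (S.isProbWeight_weights γ u) (fun i π =>
      if ε * √(S.variance γ u (S.stat γ θ₀)) < |S.centeredOf γ θ₀ u i π|
        then S.centeredOf γ θ₀ u i π ^ 2 else 0) i, expect_eq]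

/-- The centered contributions, divided by the standard deviation of the bounding statistic. -/
noncomputable def standardized (γ θ₀ : ℝ) (u : S.Confounders) (i : Fin I)
    (π : Equiv.Perm (Fin (S.n i))) : ℝ :=
  (√(S.variance γ u (S.stat γ θ₀)))⁻¹ * S.centeredOf γ θ₀ u i π

lemma isLindebergArray {γ θ₀ : ℝ} {u : S.Confounders} {ε : ℝ}
    (hvar : 0 < S.variance γ u (S.stat γ θ₀))
    (hlind : S.lindebergSum γ θ₀ u ε ≤ ε * S.variance γ u (S.stat γ θ₀)) :
    IsLindebergArray (S.weights γ u) (S.standardized γ θ₀ u) ε := by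
  have hσ := Real.sqrt_pos.2 hvar
  have hsq : (√(S.variance γ u (S.stat γ θ₀)))⁻¹ ^ 2 = (S.variance γ u (S.stat γ θ₀))⁻¹ := by
    rw [inv_pow, Real.sq_sqrt hvar.le]
  refine ⟨S.isProbWeight_weights γ u, fun i => ?_, ?_, ?_⟩
  · have : S.standardized γ θ₀ u i
        = fun π => (√(S.variance γ u (S.stat γ θ₀)))⁻¹ * S.centeredOf γ θ₀ u i π := rfl
    rw [this, wMean_const_mul, wMean_centeredOf, mul_zero]
  · simp only [standardized, mul_pow, hsq, wMean_const_mul]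
    rw [← Finset.mul_sum, ← variance_stat, inv_mul_cancel₀ hvar.ne']
  · have hterm : ∀ i, wMean (S.weights γ u i) (fun π => if ε < |S.standardized γ θ₀ u i π|
          then S.standardized γ θ₀ u i π ^ 2 else 0)
        = (S.variance γ u (S.stat γ θ₀))⁻¹ * wMean (S.weights γ u i) (fun π =>
          if ε * √(S.variance γ u (S.stat γ θ₀)) < |S.centeredOf γ θ₀ u i π|
            then S.centeredOf γ θ₀ u i π ^ 2 else 0) := by
      intro i
      rw [← wMean_const_mul]
      congr 1; ext π
      have hiff : ε < |S.standardized γ θ₀ u i π|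
          ↔ ε * √(S.variance γ u (S.stat γ θ₀)) < |S.centeredOf γ θ₀ u i π| := by
        rw [standardized, abs_mul, abs_of_pos (inv_pos.2 hσ), inv_mul_eq_div, lt_div_iff₀ hσ]
      simp only [hiff, mul_ite, mul_zero]
      rw [standardized, mul_pow, hsq]
    rw [Finset.sum_congr rfl fun i _ => hterm i, ← Finset.mul_sum, ← lindebergSum_eq,
      inv_mul_le_iff₀ hvar]
    linarith

/-- The variance estimator, as a residual quadratic form in the standardized contributions. -/
lemma varEst_eq (hI : 0 < I) {L : ℕ} (Q : Matrix (Fin I) (Fin L) ℝ) {γ θ₀ : ℝ}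
    {u : S.Confounders} (hvar : 0 < S.variance γ u (S.stat γ θ₀)) :
    ∃ m : Fin I → ℝ, ∀ a, S.varEst Q γ θ₀ a = S.variance γ u (S.stat γ θ₀) *
      ((m + fun i => (√(1 - hatMatrix Q i i))⁻¹ * S.standardized γ θ₀ u i (a i)) ⬝ᵥ
        ((1 - hatMatrix Q) *ᵥ
          (m + fun i => (√(1 - hatMatrix Q i i))⁻¹ * S.standardized γ θ₀ u i (a i)))) := by
  set σ := √(S.variance γ u (S.stat γ θ₀)) with hσdef
  have hσ : 0 < σ := Real.sqrt_pos.2 hvar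
  have hσ2 : S.variance γ u (S.stat γ θ₀) = σ * σ := (Real.mul_self_sqrt hvar.le).symm
  have hI' : (I : ℝ) ≠ 0 := by exact_mod_cast hI.ne'
  -- The vector `m` collects the weighted set means, rescaled like the noise. The factor `I` in the
  -- weights cancels against `I⁻²`.
  refine ⟨fun i => (√(1 - hatMatrix Q i i))⁻¹ * (σ⁻¹ * ((S.n i : ℝ) / S.N * S.setMean γ θ₀ u i)),
    fun a => ?_⟩
  set b : Fin I → ℝ := (fun i => (√(1 - hatMatrix Q i i))⁻¹ *
    (σ⁻¹ * ((S.n i : ℝ) / S.N * S.setMean γ θ₀ u i)))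
    + fun i => (√(1 - hatMatrix Q i i))⁻¹ * S.standardized γ θ₀ u i (a i) with hb
  have hW : S.weightMatrix *ᵥ S.scaledStat Q γ θ₀ a = ((I : ℝ) * σ) • b := by
    ext i
    rw [weightMatrix, Matrix.mulVec_diagonal, hb]
    simp only [scaledStat, setStat_eq, Pi.smul_apply, Pi.add_apply, standardized, centeredOf,
      smul_eq_mul, ← hσdef]
    field_simp
    ring
  have hW' : S.scaledStat Q γ θ₀ a ᵥ* S.weightMatrix = ((I : ℝ) * σ) • b := by
    rw [← hW, ← Matrix.mulVec_transpose, weightMatrix, Matrix.diagonal_transpose]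
  rw [varEst, ← Matrix.mulVec_mulVec, ← Matrix.mulVec_mulVec, hW, Matrix.dotProduct_mulVec, hW',
    Matrix.mulVec_smul, smul_dotProduct, dotProduct_smul, hσ2, smul_eq_mul, smul_eq_mul]
  field_simp

/-- Rejection forces the standardized statistic to be large or the variance estimator to be
small. -/
lemma reject_subset (hI : 0 < I) {L : ℕ} (Q : Matrix (Fin I) (Fin L) ℝ) {γ θ₀ α z η : ℝ}
    (hθ : S.theta = θ₀) {u : S.Confounders} (hu : u ∈ S.cube)
    (hvar : 0 < S.variance γ u (S.stat γ θ₀)) (hz : 0 ≤ z)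
    (hzα : cdf (gaussianReal 0 1) z = 1 - α) (hη : η < 1) :
    {a | S.pValue Q γ θ₀ a ≤ α} ⊆
      {a | S.varEst Q γ θ₀ a < (1 - η) * S.variance γ u (S.stat γ θ₀)} ∪
      {a | z * √(1 - η) ≤ ∑ i, S.standardized γ θ₀ u i (a i)} := by
  intro a ha
  rw [Set.mem_ofPred_eq, pValue] at ha
  by_cases hS : S.varEst Q γ θ₀ a < (1 - η) * S.variance γ u (S.stat γ θ₀)
  · exact Or.inl hS
  right
  push Not at hS
  have hσ : 0 < √(S.variance γ u (S.stat γ θ₀)) := Real.sqrt_pos.2 hvar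
  have hle : z ≤ S.stat γ θ₀ a / √(S.varEst Q γ θ₀ a) := by
    rw [← strictMono_cdf_gaussianReal.le_iff_le]
    linarith
  -- Positivity excludes the default value of division by zero in the test ratio.
  have hpos : 0 < S.varEst Q γ θ₀ a := lt_of_lt_of_le (mul_pos (by linarith) hvar) hS
  rw [le_div_iff₀ (Real.sqrt_pos.2 hpos)] at hle
  have hsqrt := Real.sqrt_le_sqrt hS
  rw [Real.sqrt_mul (by linarith)] at hsqrt
  have h1 := mul_le_mul_of_nonneg_left hsqrt hz
  have h2 := S.stat_sub_expect γ θ₀ u a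
  have h3 := S.expect_stat_nonpos hI (γ := γ) hθ hu
  simp only [Set.mem_ofPred_eq, standardized]
  rw [← Finset.mul_sum, ← h2, inv_mul_eq_div, le_div_iff₀ hσ]
  linarith

end MatchedStudy

/-! ### Asymptotic level of the test -/

theorem mainTheorem3 (γ θ₀ : ℝ)
    -- for every `I`, a study with `I` matched sets and an `I × L` covariate matrix `Q`
    (S : ∀ I : ℕ, MatchedStudy I) (L : ℕ → ℕ) (Q : ∀ I : ℕ, Matrix (Fin I) (Fin (L I)) ℝ)
    -- the confounder vectors over which validity is uniform, for instance the whole cube, or one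
    -- vector for each `I`
    (U : ∀ I : ℕ, Set (S I).Confounders) (hU : ∀ I, U I ⊆ (S I).cube)
    -- regularity of `Q`: full column rank, and leverages bounded away from one
    (hQ : ∀ᶠ I in atTop, IsUnit ((Q I)ᵀ * Q I).det)
    (hlev : ∃ δ : ℝ, 0 < δ ∧ ∀ᶠ I in atTop, ∀ i, hatMatrix (Q I) i i ≤ 1 - δ)
    -- regularity of the matched sets: non-degeneracy and the Lindeberg condition
    (hvar : ∀ᶠ I in atTop, ∀ u ∈ U I, 0 < (S I).variance γ u ((S I).stat γ θ₀))
    (hlind : ∀ ε : ℝ, 0 < ε → ∀ᶠ I in atTop, ∀ u ∈ U I,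
      (S I).lindebergSum γ θ₀ u ε ≤ ε * (S I).variance γ u ((S I).stat γ θ₀))
    -- the null hypothesis
    (hnull : ∀ᶠ I in atTop, (S I).theta = θ₀)
    (α : ℝ) (hα₀ : 0 < α) (hα : α ≤ 1 / 2) :
    ∀ ε : ℝ, 0 < ε → ∀ᶠ I in atTop, ∀ u ∈ U I,
      (S I).prob γ u {a | (S I).pValue (Q I) γ θ₀ a ≤ α} ≤ α + ε := by
  intro ε hε
  obtain ⟨δ, hδ, hlev⟩ := hlev
  obtain ⟨z, hz, hzα⟩ := exists_cdf_gaussianReal_eq hα₀ hα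
  -- a threshold slightly below the quantile
  obtain ⟨η, hηcdf, hη1, hη0⟩ : ∃ η : ℝ, 1 - α - ε / 3 < cdf (gaussianReal 0 1) (z * √(1 - η))
      ∧ η < 1 ∧ 0 < η := by
    have hc : Continuous fun η : ℝ => cdf (gaussianReal 0 1) (z * √(1 - η)) :=
      continuous_cdf_gaussianReal.comp (by fun_prop)
    have ht := (hc.tendsto 0).mono_left (nhdsWithin_le_nhds (s := Set.Ioi 0))
    simp only [sub_zero, Real.sqrt_one, mul_one, hzα] at ht
    have h1 : ∀ᶠ η : ℝ in 𝓝[>] 0, η < 1 :=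
      nhdsWithin_le_nhds (eventually_lt_nhds one_pos)
    obtain ⟨η, ⟨hη, hη1⟩, hη0⟩ := ((ht.eventually_const_lt
      (show 1 - α - ε / 3 < 1 - α by linarith)).and h1).and self_mem_nhdsWithin |>.exists
    exact ⟨η, hη, hη1, hη0⟩
  -- the filter of large studies with admissible confounders
  let l : Filter (Σ I, (S I).Confounders) := comap Sigma.fst atTop ⊓ 𝓟 {q | q.2 ∈ U q.1}
  have hl : ∀ {R : (Σ I, (S I).Confounders) → Prop},
      (∀ᶠ q in l, R q) ↔ ∀ᶠ I in atTop, ∀ u ∈ U I, R ⟨I, u⟩ := by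
    intro R
    rw [eventually_inf_principal, eventually_comap]
    refine eventually_congr (Eventually.of_forall fun I => ⟨fun h u hu => h ⟨I, u⟩ rfl hu, ?_⟩)
    rintro h ⟨_, u⟩ rfl hu
    exact h u hu
  have harray : ∀ ε' : ℝ, 0 < ε' → ∀ᶠ q in l, IsLindebergArray ((S q.1).weights γ q.2)
      ((S q.1).standardized γ θ₀ q.2) ε' := by
    intro ε' hε'
    rw [hl]
    filter_upwards [hvar, hlind ε' hε'] with I h1 h2 u hu
    exact (S I).isLindebergArray (h1 u hu) (h2 u hu)
  -- The budget `ε` is split in three: moving the threshold by the factor `√(1 - η)`, the normal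
  -- approximation, and the failure of the variance estimator.
  have hclt := hl.1 ((tendsto_wProb_sum_ge (fun q => (S q.1).isProbWeight_weights γ q.2) harray
    (z * √(1 - η))).eventually_lt_const (show _ < α + ε / 3 + ε / 3 by linarith))
  -- the truncation level for the variance estimator
  obtain ⟨ε', hbound, hε'η, hε'⟩ : ∃ ε' : ℝ, 36 * ε' ^ 2 / η ^ 2 + 12 * (ε' ^ 2 + ε') / (δ * η)
      + 18 * (ε' ^ 2 + ε') / (δ ^ 2 * η ^ 2) < ε / 3 ∧ ε' < η / 6 ∧ 0 < ε' := by
    have hc : Continuous fun ε' : ℝ => 36 * ε' ^ 2 / η ^ 2 + 12 * (ε' ^ 2 + ε') / (δ * η)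
      + 18 * (ε' ^ 2 + ε') / (δ ^ 2 * η ^ 2) := by fun_prop
    have ht := (hc.tendsto 0).mono_left (nhdsWithin_le_nhds (s := Set.Ioi 0))
    have h1 : ∀ᶠ ε' : ℝ in 𝓝[>] 0, ε' < η / 6 :=
      nhdsWithin_le_nhds (eventually_lt_nhds (by positivity))
    obtain ⟨ε', ⟨hb, h6⟩, h0⟩ := ((ht.eventually_lt_const
      (show _ < ε / 3 by simpa using hε)).and h1).and self_mem_nhdsWithin |>.exists
    exact ⟨ε', hb, h6, h0⟩
  filter_upwards [hclt, hl.1 (harray ε' hε'), hvar, hnull, hQ, hlev, eventually_gt_atTop 0]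
    with I hclt harr hvar hnull hQ hlev hI u hu
  have hP := IsProbWeight.prodWeight ((S I).isProbWeight_weights γ u)
  obtain ⟨m, hm⟩ := (S I).varEst_eq hI (Q I) (hvar u hu)
  have hres := (harr u hu).wProb_residual_lt hε' hη0 hε'η.le hδ (hatMatrix_transpose (Q I))
    (hatMatrix_mul_self hQ) hlev m
  have hsub : {a | (S I).varEst (Q I) γ θ₀ a < (1 - η) * (S I).variance γ u ((S I).stat γ θ₀)} ⊆
      {a | (m + fun i => (√(1 - hatMatrix (Q I) i i))⁻¹ * (S I).standardized γ θ₀ u i (a i)) ⬝ᵥ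
        ((1 - hatMatrix (Q I)) *ᵥ (m + fun i => (√(1 - hatMatrix (Q I) i i))⁻¹ *
          (S I).standardized γ θ₀ u i (a i))) < 1 - η} := by
    intro a ha
    rw [Set.mem_ofPred_eq, hm, mul_comm] at ha
    exact lt_of_mul_lt_mul_right ha (hvar u hu).le
  have h1 := hP.wProb_mono ((S I).reject_subset hI (Q I) hnull (hU I hu) (hvar u hu) hz hzα hη1)
  have h2 := hP.wProb_union_le
    {a | (S I).varEst (Q I) γ θ₀ a < (1 - η) * (S I).variance γ u ((S I).stat γ θ₀)}
    {a | z * √(1 - η) ≤ ∑ i, (S I).standardized γ θ₀ u i (a i)}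
  have h3 := hP.wProb_mono hsub
  have h4 := hclt u hu
  rw [MatchedStudy.prob_eq]
  linarith
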